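/- **Setting.** Let $\mathbb K$ be an ordered field. Suppose that for all $n\in\mathbb N$ and $r\in(\mathbb K^{>0})^n$ we are given a $\mathbb K$-algebra $L(r)$ of $C^\infty$ functions $\prod_{i<n}(0,r_i)\to\mathbb K$ containing the coordinate projections $x_i$, such that for every $n$ the germs at the origin (along positive tuples) of the $n$-ary functions in the $L(r)$ form a $\mathbb K$-algebra $L_n$. Let $\mathbb K_L$ be the structure on $\mathbb K$ in the language $L$ consisting of $0,1,+,-,\cdot,(-)^{-1},<$ (with $0^{-1}=0$) and a function symbol for each $f\in L(r)$, interpreted as $f$ on $\prod_{i<n}(0,r_i)$ and as $0$ elsewhere. Assume that $\mathbb K_L$ is o-minimal and power-bounded, i.e. every definable function $\mathbb K\to\mathbb K$ is ultimately bounded by a power function, where a power function is a definable endomorphism $p$ of $(\mathbb K^{>0},\cdot)$; its exponent is $a=p'(1)$ and one writes $p(k)=k^a$. Let $\Lambda\subseteq\mathbb K$ be the field of exponents. For $n\in\mathbb N$ let $\mathbb K(\!(\mathrm x^\Lambda)\!)$ be the ring of generalized power series $\sum_{\gamma\in\Lambda^n}c_\gamma \mathrm x^\gamma$ whose support $\{\gamma: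 c_\gamma\ne0\}$ is a well-partial order for the product order. Let $\mathcal T=(\mathcal T_n)_n$ be injective $\mathbb K$-algebra homomorphisms $\mathcal T_n:L_n\to\mathbb K(\!(\mathrm x^\Lambda)\!)$ with $\mathcal T_n(x_i)=\mathrm x_i$, and $\mathcal T_n(x_i\partial_i f)=\mathrm x_i\partial_i\mathcal T_n(f)$ whenever $f$ and $x_i\partial_i f$ lie in $L_n$. Call $(\mathbb K_L,\mathcal T)$ *truncation-closed* if for all $n$ the image of $\mathcal T_n$ is closed under truncations in each variable, i.e. under $\sum_\gamma c_\gamma \mathrm x^\gamma\mapsto\sum_{\gamma_i<b}c_\gamma \mathrm x^\gamma$ for $i<n$, $b\in\Lambda$ (equivalently, under restriction to order-convex sets of exponents). Let $\mathfrak M$ be a multiplicatively written totally ordered $\Lambda$-vector space and $\mathbb K(\!(\mathfrak M)\!)$ the Hahn field of series $\sum_{\mathfrak m} k_{\mathfrak m}\mathfrak m$ with reverse well-ordered support, ordered by the sign of the leading coefficient. A generalized power series $f=\sum_\gamma c_\gamma\mathrm x^\gamma$ is evaluated at tuples of positive infinitesimals $\mathfrak m_i(k_i+\varepsilon_i)$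 ($\mathfrak m_i\in\mathfrak M^{<1}$, $k_i\in\mathbb K^{>0}$, $\varepsilon_i\in\mathbb K(\!(\mathfrak M^{<1})\!)$) by $$f(\mathfrak m(k+\varepsilon))=\sum_{m\in\mathbb N^n}\sum_\gamma\binom{\gamma}{m}c_\gamma k^{\gamma-m}\mathfrak m^\gamma\varepsilon^m .$$ Say that $(\mathbb K_L,\mathcal T)$ is *$\mathfrak M$-serial* if 1. for every $f\in L(r)$, $x\in\prod_{i<n}[0,r_i]$ and $\sigma\in\{-1,0,1\}^n$ there are $r'$ and $f_{x,\sigma}\in L(r')$ with $f(x+\sigma z)=f_{x,\sigma}(z)$ for all small enough $z>0$ (with $f=0$ outside its box); 2. each $L_n$ is closed under the renormalized derivatives $f\mapsto x_i\partial_i f$; 3. the theory of $\mathbb K_L$ is piecewise Skolem: for each formula $\varphi(x,y)$, with $y$ a single variable, there are finitely many terms $t_0(x),\dots,t_{l-1}(x)$ such that it proves $\forall x\,\big(\exists y\,\varphi(x,y)\to\bigvee_{j<l}\varphi(x,t_j(x))\big)$; 4. $\mathbb K_L\preceq\mathbb K(\!(\mathfrak M)\!)^{\mathcal T}$, the latter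 being the ordered field $\mathbb K(\!(\mathfrak M)\!)$ in which $f\in L(r)$ is interpreted by $f(x+\varepsilon):=\mathcal T(f_{x,\mathrm{sign}\,\varepsilon})(|\varepsilon|)$ for $x\in\prod_{i<n}[0,r_i]$ in $\mathbb K$ and $\varepsilon$ a tuple of infinitesimals with $0<x_i+\varepsilon_i<r_i$ for all $i$, and by $0$ elsewhere. (If $\varepsilon_i=0$, then $\mathcal T(f_{x,\mathrm{sign}\,\varepsilon})$ does not involve $\mathrm x_i$.) For $f=\sum_{\mathfrak n} k_{\mathfrak n}\mathfrak n\in\mathbb K(\!(\mathfrak M)\!)$ and $\mathfrak m\in\mathfrak M$ put $f|\mathfrak m:=\sum_{\mathfrak n>\mathfrak m}k_{\mathfrak n}\mathfrak n$. A subset of $\mathbb K(\!(\mathfrak M)\!)$ is *truncation-closed* if it contains $f|\mathfrak m$ for all its elements $f$ and all $\mathfrak m\in\mathfrak M$. **Proposition.** Suppose that $(\mathbb K_L,\mathcal T)$ is $\mathfrak M$-serial and truncation-closed, and let $\mathbb K\subseteq\mathbb E\preceq\mathbb K(\!(\mathfrak M)\!)^{\mathcal T}$ be a truncation-closed elementary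 substructure. Let $x\in\mathbb K(\!(\mathfrak M)\!)$ be such that for all $\mathfrak m\in\mathfrak M$, if $x|\mathfrak m\neq x$ then $x|\mathfrak m\in\mathbb E$. Then the definable closure $\mathbb E\langle x\rangle_L$ of $\mathbb E\cup\{x\}$ in $\mathbb K(\!(\mathfrak M)\!)^{\mathcal T}$ is truncation-closed. -/

import Mathlib

open FirstOrder

universe u v

noncomputable section

open scoped Classical in
/-- The fragment `f|S` of a generalized series: only the terms with exponent in `S` are kept. -/
def HahnSeries.fragment {G R : Type*} [PartialOrder G] [Zero R] (f : HahnSeries G R) (S : Set G) :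
    HahnSeries G R where
  coeff g := if g ∈ S then f.coeff g else 0
  isPWO_support' := f.isPWO_support.mono fun g hg => by
    simp only [Function.mem_support, ne_eq, ite_eq_right_iff, Classical.not_imp] at hg
    exact hg.2

/-- The truncation of `f` at the monomial `t ^ g`: only the terms whose monomial is strictly larger
than `t ^ g` are kept. As `t` is thought of as a positive infinitesimal, these are the terms with
exponent `< g`. -/
def HahnSeries.truncation {G R : Type*} [PartialOrder G] [Zero R] (f : HahnSeries G R) (g : G) :
    HahnSeries G R :=
  f.fragment (Set.Iio g)

/-- A set of generalized series is truncation-closed if it contains all truncations of its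
elements. -/
def TruncationClosed {G R : Type*} [PartialOrder G] [Zero R] (X : Set (HahnSeries G R)) : Prop :=
  ∀ f ∈ X, ∀ g : G, f.truncation g ∈ X

open scoped Classical in
/-- The sum of a summable family of generalized series (`0` if the family is not summable). -/
def hahnSum {G R ι : Type*} [PartialOrder G] [AddCommMonoid R] (F : ι → HahnSeries G R) :
    HahnSeries G R :=
  if h : (⋃ i, (F i).support).IsPWO ∧ ∀ g, {i | (F i).coeff g ≠ 0}.Finite then
    HahnSeries.SummableFamily.hsum ⟨F, h.1, h.2⟩
  else 0

/-- The definable closure of `A` in a first-order structure. -/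
def definableClosure (L : FirstOrder.Language) {M : Type*} [L.Structure M] (A : Set M) : Set M :=
  {y | A.Definable₁ L {y}}

/-- A structure on a linear order is o-minimal if every subset of the line definable with
parameters is a finite union of points and open intervals. -/
def IsOMinimal (L : FirstOrder.Language) (M : Type*) [LinearOrder M] [L.Structure M] : Prop :=
  ∀ S : Set M, (Set.univ : Set M).Definable₁ L S → ∃ F : Set (Set M), F.Finite ∧ ⋃₀ F = S ∧
    ∀ I ∈ F, (∃ a, I = {a}) ∨ (∃ a b, I = Set.Ioo a b) ∨ (∃ a, I = Set.Iio a) ∨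
      (∃ a, I = Set.Ioi a) ∨ I = Set.univ

/-- A theory is piecewise Skolem if, for every formula `φ(x, y)`, finitely many terms `t(x)` suffice
to provide a witness for `∃ y, φ(x, y)` whenever there is one. -/
def IsPiecewiseSkolem {L : FirstOrder.Language.{u, 0}} (T : L.Theory) : Prop :=
  ∀ (n : ℕ) (φ : L.Formula (Fin n ⊕ Unit)), ∃ s : Finset (L.Term (Fin n)),
    ∀ (M : FirstOrder.Language.Theory.ModelType.{u, 0, u} T) (x : Fin n → M),
      (∃ y : M, φ.Realize (Sum.elim x fun _ => y)) →
        ∃ t ∈ s, φ.Realize (Sum.elim x fun _ => t.realize x)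

section OrderedField

variable {K : Type u} [Field K] [LinearOrder K] [IsStrictOrderedRing K]

/-- `g` is differentiable at `a` with derivative `d`. -/
def HasDerivative (g : K → K) (a d : K) : Prop :=
  ∀ ε > 0, ∃ δ > 0, ∀ h : K, |h| < δ → |g (a + h) - g a - d * h| ≤ ε * |h|

/-- `g` has at `x` an `i`-th partial derivative, equal to `d`. -/
def HasPartialDerivative {n : ℕ} (g : (Fin n → K) → K) (i : Fin n) (x : Fin n → K) (d : K) :
    Prop :=
  HasDerivative (fun t => g (Function.update x i t)) (x i) d

def IsContinuousOn {n : ℕ} (g : (Fin n → K) → K) (U : Set (Fin n → K)) : Prop :=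
  ∀ x ∈ U, ∀ ε > 0, ∃ δ > 0, ∀ y ∈ U, (∀ i, |y i - x i| < δ) → |g y - g x| < ε

/-- `g` is `k` times continuously differentiable on the open set `U`. -/
def IsCkOn {n : ℕ} (U : Set (Fin n → K)) : ℕ → ((Fin n → K) → K) → Prop
  | 0, g => IsContinuousOn g U
  | k + 1, g => IsContinuousOn g U ∧ ∀ i, ∃ g' : (Fin n → K) → K,
      (∀ x ∈ U, HasPartialDerivative g i x (g' x)) ∧ IsCkOn U k g'

def IsSmoothOn {n : ℕ} (g : (Fin n → K) → K) (U : Set (Fin n → K)) : Prop :=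
  ∀ k, IsCkOn U k g

/-- The filter of small positive tuples: a property holds eventually along it iff for some `δ > 0`
it holds on the box `(0, δ)ⁿ`. -/
def smallPos (K : Type u) [Field K] [LinearOrder K] (n : ℕ) : Filter (Fin n → K) :=
  ⨅ δ : {δ : K // 0 < δ}, Filter.principal {z | ∀ i, 0 < z i ∧ z i < δ}

theorem eventually_smallPos {n : ℕ} {P : (Fin n → K) → Prop} :
    (∀ᶠ z in smallPos K n, P z) ↔ ∃ δ > 0, ∀ z, (∀ i, 0 < z i ∧ z i < δ) → P z := by
  have : Nonempty {δ : K // 0 < δ} := ⟨⟨1, one_pos⟩⟩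
  have hd : Directed (· ≥ ·) fun δ : {δ : K // 0 < δ} =>
      Filter.principal {z : Fin n → K | ∀ i, 0 < z i ∧ z i < δ} := by
    intro a b
    refine ⟨⟨min a.1 b.1, lt_min a.2 b.2⟩, ?_, ?_⟩ <;>
      · simp only [ge_iff_le, Filter.le_principal_iff, Filter.mem_principal]
        intro z hz i
        have := hz i
        simp only [lt_min_iff] at this
        tauto
  rw [smallPos, Filter.Eventually, Filter.mem_iInf_of_directed hd]
  simp only [Filter.mem_principal, Subtype.exists, Set.subset_def, Set.mem_ofPred_eq]
  exact ⟨fun ⟨d, h, H⟩ => ⟨d, h, H⟩, fun ⟨d, h, H⟩ => ⟨d, h, H⟩⟩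

/-- The open box `∏ (0, rᵢ)`. -/
abbrev PosBox {n : ℕ} (r : Fin n → {k : K // 0 < k}) : Type u :=
  {x : Fin n → K // ∀ i, 0 < x i ∧ x i < r i}

open scoped Classical in
/-- Extension of a function on a box by `0` outside the box. -/
def PosBox.extend {n : ℕ} {r : Fin n → {k : K // 0 < k}} (f : PosBox r → K) (x : Fin n → K) : K :=
  if h : ∀ i, 0 < x i ∧ x i < r i then f ⟨x, h⟩ else 0

open scoped Classical in
/-- Extension by `0` of an endomorphism of the multiplicative group of positive elements. -/
def extendPos (p : {x : K // 0 < x} →* {x : K // 0 < x}) (x : K) : K :=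
  if h : 0 < x then (p ⟨x, h⟩ : K) else 0

variable (K) in
/-- For every `n` and every `r ∈ (K^{>0})ⁿ`, a `K`-algebra `L(r)` of smooth functions on
`∏ (0, rᵢ)` which contains the coordinate projections, such that the germs at the origin of the
`n`-ary functions of the family are closed under sums and products. -/
structure FunctionFamily where
  alg : {n : ℕ} → (r : Fin n → {k : K // 0 < k}) → Subalgebra K (PosBox r → K)
  proj_mem : ∀ {n : ℕ} (r : Fin n → {k : K // 0 < k}) (i : Fin n),
    (fun x : PosBox r => x.1 i) ∈ alg r
  smooth : ∀ {n : ℕ} (r : Fin n → {k : K // 0 < k}), ∀ f ∈ alg r,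
    IsSmoothOn (PosBox.extend f) {x | ∀ i, 0 < x i ∧ x i < r i}
  germ_add : ∀ {n : ℕ} (r s : Fin n → {k : K // 0 < k}), ∀ f ∈ alg r, ∀ g ∈ alg s,
    ∃ t, ∃ h ∈ alg t, ∀ᶠ z in smallPos K n,
      PosBox.extend h z = PosBox.extend f z + PosBox.extend g z
  germ_mul : ∀ {n : ℕ} (r s : Fin n → {k : K // 0 < k}), ∀ f ∈ alg r, ∀ g ∈ alg s,
    ∃ t, ∃ h ∈ alg t, ∀ᶠ z in smallPos K n,
      PosBox.extend h z = PosBox.extend f z * PosBox.extend g z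

namespace FunctionFamily

variable (L : FunctionFamily K)

/-- The function symbols: those of fields (with inversion), and one for every function of the
family. -/
inductive Func : ℕ → Type u
  | zero : Func 0
  | one : Func 0
  | neg : Func 1
  | inv : Func 1
  | add : Func 2
  | mul : Func 2
  | sym {n : ℕ} (r : Fin n → {k : K // 0 < k}) (f : L.alg r) : Func n

/-- The only relation symbol is that for the strict order. -/
inductive Rel : ℕ → Type
  | lt : Rel 2

def language : FirstOrder.Language.{u, 0} where
  Functions := L.Func
  Relations := Rel

/-- `K` as a structure: the field symbols and the order have their usual meaning (with `0⁻¹ = 0`),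
and the symbols of the family are interpreted by the functions extended by `0`. -/
instance : L.language.Structure K where
  funMap {_} F x := match F, x with
    | .zero, _ => 0
    | .one, _ => 1
    | .neg, x => - x 0
    | .inv, x => (x 0)⁻¹
    | .add, x => x 0 + x 1
    | .mul, x => x 0 * x 1
    | .sym _ f, x => PosBox.extend f.1 x
  RelMap {_} R x := match R, x with
    | .lt, x => x 0 < x 1

/-- A power function: a definable endomorphism of the multiplicative group of positive elements. -/
def IsPowerFunction (p : {x : K // 0 < x} →* {x : K // 0 < x}) : Prop :=
  (Set.univ : Set K).DefinableFun L.language fun v : Fin 1 → K => extendPos p (v 0)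

/-- The power function `p` has exponent `a`, i.e. it is `x ↦ x ^ a`: its derivative at `1` is `a`. -/
def IsPowerWithExponent (p : {x : K // 0 < x} →* {x : K // 0 < x}) (a : K) : Prop :=
  L.IsPowerFunction p ∧ HasDerivative (extendPos p) 1 a

/-- Every definable function `K → K` is ultimately bounded by a power function. -/
def IsPowerBounded : Prop :=
  ∀ f : K → K, (Set.univ : Set K).DefinableFun L.language (fun v : Fin 1 → K => f (v 0)) →
    ∃ p, L.IsPowerFunction p ∧ ∃ b, ∀ x > b, |f x| ≤ extendPos p x

/-- The field of exponents, i.e. the field whose elements are the exponents of the power functions.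
(In an o-minimal structure these form a subfield, so that taking the generated subfield adds
nothing.) -/
def exponents : Subfield K :=
  Subfield.closure {a | ∃ p, L.IsPowerWithExponent p a}

open scoped Classical in
/-- `k ^ a`, for `k > 0` and an exponent `a`. -/
def power (a k : K) : K :=
  if h : ∃ p, L.IsPowerWithExponent p a then extendPos h.choose k else 0

/-- The germs at the origin, along positive tuples, of the `n`-ary functions of the family. -/
def germs (n : ℕ) : Subring ((smallPos K n).Germ K) where
  carrier := {φ | ∃ r : Fin n → {k : K // 0 < k}, ∃ f ∈ L.alg r, φ = ↑(PosBox.extend f)}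
  add_mem' := by
    rintro _ _ ⟨r, f, hf, rfl⟩ ⟨s, g, hg, rfl⟩
    obtain ⟨t, h, hh, H⟩ := L.germ_add r s f hf g hg
    exact ⟨t, h, hh, (Filter.Germ.coe_eq.2 H).symm⟩
  mul_mem' := by
    rintro _ _ ⟨r, f, hf, rfl⟩ ⟨s, g, hg, rfl⟩
    obtain ⟨t, h, hh, H⟩ := L.germ_mul r s f hf g hg
    exact ⟨t, h, hh, (Filter.Germ.coe_eq.2 H).symm⟩
  zero_mem' := ⟨fun _ => ⟨1, one_pos⟩, 0, zero_mem _, Filter.Germ.coe_eq.2 <|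
    Filter.Eventually.of_forall fun z => by simp [PosBox.extend]⟩
  one_mem' := ⟨fun _ => ⟨1, one_pos⟩, 1, one_mem _, Filter.Germ.coe_eq.2 <|
    eventually_smallPos.2 ⟨1, one_pos, fun z hz => by simp [PosBox.extend, hz]⟩⟩
  neg_mem' := by
    rintro _ ⟨r, f, hf, rfl⟩
    refine ⟨r, -f, neg_mem hf, Filter.Germ.coe_eq.2 <| Filter.Eventually.of_forall fun z => ?_⟩
    by_cases h : ∀ i, 0 < z i ∧ z i < r i <;> simp [PosBox.extend, h]

/-- Generalized power series in `n` variables with exponents in the field of exponents: the support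
is a well-partial order for the product order on the exponents. -/
abbrev Series (n : ℕ) : Type u := HahnSeries (Fin n → L.exponents) K

variable {L} in
/-- The renormalized formal derivative `xᵢ ∂ᵢ`, i.e. `∑ c_γ x^γ ↦ ∑ γᵢ c_γ x^γ`. -/
def Series.euler {n : ℕ} (i : Fin n) (f : L.Series n) : L.Series n where
  coeff γ := (γ i : K) * f.coeff γ
  isPWO_support' := f.isPWO_support.mono fun γ hγ => by
    simp only [Function.mem_support, ne_eq] at hγ
    exact right_ne_zero_of_mul hγ

/-- Near the origin, `g` is the renormalized derivative `xᵢ ∂ᵢ f`. -/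
def IsEulerDerivative {n : ℕ} (i : Fin n) (f g : (Fin n → K) → K) : Prop :=
  ∀ᶠ z in smallPos K n, ∃ d, HasPartialDerivative f i z d ∧ g z = z i * d

/-- For every `n`, an injective `K`-algebra homomorphism from the algebra of germs to generalized
power series, which sends coordinates to variables and commutes with renormalized derivatives. -/
structure SeriesRep where
  hom : (n : ℕ) → L.germs n →+* L.Series n
  injective : ∀ n, Function.Injective (hom n)
  map_const : ∀ (n : ℕ) (c : K) (φ : L.germs n), φ.1 = (c : (smallPos K n).Germ K) →
    hom n φ = HahnSeries.C c
  map_proj : ∀ (n : ℕ) (i : Fin n) (φ : L.germs n),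
    φ.1 = ((fun z : Fin n → K => z i : (Fin n → K) → K) : (smallPos K n).Germ K) →
    hom n φ = HahnSeries.single (Pi.single i 1) 1
  map_euler : ∀ (n : ℕ) (i : Fin n) (φ ψ : L.germs n) (f g : (Fin n → K) → K),
    φ.1 = (f : (smallPos K n).Germ K) → ψ.1 = (g : (smallPos K n).Germ K) →
    IsEulerDerivative i f g → hom n ψ = (hom n φ).euler i

/-- Any function of the family can be represented, near every point of the closed box and in every
direction, by a function of the family. -/
def IsAnalytic : Prop :=
  ∀ (n : ℕ) (r : Fin n → {k : K // 0 < k}), ∀ f ∈ L.alg r,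
    ∀ x : Fin n → K, (∀ i, 0 ≤ x i ∧ x i ≤ r i) → ∀ σ : Fin n → SignType,
      ∃ r' : Fin n → {k : K // 0 < k}, ∃ f' ∈ L.alg r', ∀ᶠ z in smallPos K n,
        PosBox.extend f (fun i => x i + (σ i : K) * z i) = PosBox.extend f' z

/-- The algebras of germs are closed under renormalized partial derivatives. -/
def IsEulerClosed : Prop :=
  ∀ (n : ℕ) (r : Fin n → {k : K // 0 < k}), ∀ f ∈ L.alg r, ∀ i : Fin n,
    ∃ r' : Fin n → {k : K // 0 < k}, ∃ g ∈ L.alg r',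
      IsEulerDerivative i (PosBox.extend f) (PosBox.extend g)

end FunctionFamily

/-- The generalized binomial coefficient `a (a - 1) ⋯ (a - m + 1) / m!`. -/
def genBinom (a : K) (m : ℕ) : K := (∏ j ∈ Finset.range m, (a - j)) / (m.factorial : K)

namespace FunctionFamily

section Hahn

variable {L : FunctionFamily K} {Γ : Type v} [AddCommGroup Γ] [LinearOrder Γ]
  [IsOrderedAddMonoid Γ] [Module L.exponents Γ]

/-- Every `y ≠ 0` is `t ^ v * (k + ε)` with `v` its order, `k` its leading coefficient and `ε` an
infinitesimal series: this is `ε`. -/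
def tail (y : HahnSeries Γ K) : HahnSeries Γ K :=
  HahnSeries.single (-y.order) 1 * y - HahnSeries.C y.leadingCoeff

/-- Evaluation of a generalized power series `f = ∑ c_γ x^γ` at a tuple `y` of positive
infinitesimals `yᵢ = t ^ vᵢ * (kᵢ + εᵢ)`, namely
`∑_γ ∑_m (γ choose m) * c_γ * k ^ (γ - m) * t ^ (γ • v) * ε ^ m`. -/
def Series.eval {n : ℕ} (f : L.Series n) (y : Fin n → HahnSeries Γ K) : HahnSeries Γ K :=
  hahnSum fun p : (Fin n → L.exponents) × (Fin n → ℕ) =>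
    HahnSeries.C (f.coeff p.1 * ∏ i, genBinom (p.1 i : K) (p.2 i) *
        L.power ((p.1 i : K) - p.2 i) (y i).leadingCoeff) *
      HahnSeries.single (∑ i, p.1 i • (y i).order) 1 * ∏ i, tail (y i) ^ p.2 i

namespace SeriesRep

variable (T : L.SeriesRep)

open scoped Classical in
/-- The generalized power series of (the germ of) a function. -/
def series {n : ℕ} (f : (Fin n → K) → K) : L.Series n :=
  if h : (f : (smallPos K n).Germ K) ∈ L.germs n then T.hom n ⟨_, h⟩ else 0

open scoped Classical in
/-- The interpretation of a function `f` on `∏ (0, rᵢ)` in the Hahn field. If `0 < yᵢ < rᵢ` for all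
`i`, write `y = x + ε` with `x` a tuple in `K` and `ε` a tuple of infinitesimals, and let `σ` be the
tuple of signs of `ε`. The value is that at `|ε|` of the generalized power series of
`z ↦ f (x + σ z)`. For `εᵢ = 0` this series does not involve the `i`-th variable, for which we
substitute `1`. Outside of the box the value is `0`. -/
def interpret {n : ℕ} {r : Fin n → {k : K // 0 < k}} (f : L.alg r) (y : Fin n → HahnSeries Γ K) :
    HahnSeries Γ K :=
  if ∀ i, toLex 0 < toLex (y i) ∧ toLex (y i) < toLex (HahnSeries.C (r i : K)) then
    let x : Fin n → K := fun i => (y i).coeff 0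
    let ε : Fin n → HahnSeries Γ K := fun i => y i - HahnSeries.C (x i)
    let σ : Fin n → SignType := fun i => SignType.sign (ε i).leadingCoeff
    (T.series fun z => PosBox.extend f.1 fun i => x i + (σ i : K) * z i).eval
      fun i => if ε i = 0 then 1 else HahnSeries.C (σ i : K) * ε i
  else 0

/-- The underlying set of the structure: the Hahn field with coefficients in `K` and monomials
`t ^ g`, `g ∈ Γ`, where `t ^ g > t ^ h` iff `g < h`. -/
@[nolint unusedArguments]
def Hahn (_T : L.SeriesRep) (Γ : Type v) [AddCommGroup Γ] [LinearOrder Γ] : Type (max u v) :=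
  HahnSeries Γ K

instance (Γ : Type v) [AddCommGroup Γ] [LinearOrder Γ] [IsOrderedAddMonoid Γ] :
    Field (T.Hahn Γ) :=
  inferInstanceAs (Field (HahnSeries Γ K))

/-- The embedding of `K` in the Hahn field as constant series. -/
def const (Γ : Type v) [AddCommGroup Γ] [LinearOrder Γ] (k : K) : T.Hahn Γ :=
  (HahnSeries.single 0 k : HahnSeries Γ K)

/-- The Hahn field as a structure. A series is positive iff its leading coefficient is. -/
instance : L.language.Structure (T.Hahn Γ) where
  funMap {_} F x := match F, x with
    | .zero, _ => 0
    | .one, _ => 1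
    | .neg, x => - x 0
    | .inv, x => (x 0)⁻¹
    | .add, x => x 0 + x 1
    | .mul, x => x 0 * x 1
    | .sym _ f, x => T.interpret (Γ := Γ) f x
  RelMap {_} R x := match R, x with
    | .lt, x => toLex (show HahnSeries Γ K from x 0) < toLex (show HahnSeries Γ K from x 1)

/-- Seriality with respect to the ordered vector space of monomials `t ^ g`, `g ∈ Γ`: the
analyticity, derivative and Skolem conditions hold and `K` is an elementary substructure of the Hahn
field. -/
structure IsSerial (Γ : Type v) [AddCommGroup Γ] [LinearOrder Γ] [IsOrderedAddMonoid Γ]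
    [Module L.exponents Γ] : Prop where
  analytic : L.IsAnalytic
  eulerClosed : L.IsEulerClosed
  skolem : IsPiecewiseSkolem (L.language.completeTheory K)
  elementary : ∃ j : K ↪ₑ[L.language] T.Hahn Γ, ∀ k : K, j k = T.const Γ k

/-- For every `n`, the image of `T` in the generalized power series in `n` variables is closed under
(partial) truncations: discarding all terms in which a given variable has an exponent `≥ b`. -/
def IsTruncationClosed : Prop :=
  ∀ (n : ℕ), ∀ f ∈ (T.hom n).range, ∀ (i : Fin n) (b : L.exponents),
    f.fragment {γ | γ i < b} ∈ (T.hom n).range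

end SeriesRep

end Hahn

end FunctionFamily

end OrderedField

end

/-!
The definable closure `D` of `E ∪ {x}` is the substructure generated by `E ∪ {x}`: the Skolem
conditions carry over from `K` to the elementarily equivalent Hahn field, so that every definable
element is the value of a term (`definableClosure_subset_closure`). As `D` is a field which contains
the truncations of its generators, it suffices to show that the set `B` of those elements of `D` all
of whose truncations lie in `D` (`HahnSeries.coreRing`) is closed under the function symbols
(`truncationClosed_closure`).

*Products* (`HahnSeries.truncation_mul_mem`). For `p ∈ supp y` and `q ∈ supp z`, the series
`(y - y|p) * (z - z|q)` has no exponents below `p + q`. Hence `(y * z)|g`, for `g ≤ p + q`, is a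
combination of truncations of products in which a factor has been replaced by a proper truncation.
Passing to proper truncations is well-founded.

*Function symbols* (`FunctionFamily.IsTruncationAlgebra.evalAt_mem_coreRing`). If `B` consists of
constants, there is nothing to do; else `B` yields a positive infinitesimal monomial, to be
substituted for variables that do not occur. So by analyticity the values of function symbols are
those of series `F` in the image of `T` at tuples of positive infinitesimals
`yᵢ = t ^ vᵢ * (kᵢ + εᵢ)`. Let `g` be the exponent at which `F(y)` is to be truncated. The exponents
`γ` for which `γ • v + N p` reaches `g` for some `N` and some `p` in the support of an `εᵢ` form an
upper set. As supports are well-partial orders, the restriction of `F` to an upper set is obtained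
from finitely many truncations in single variables, so it remains in the image of `T`. What is left
out contributes only terms with exponents below `g`. On the rest, Taylor expansion
around a proper truncation of `εᵢ` stops, modulo terms with exponents `≥ g`, after finitely many
steps (`FunctionFamily.coeff_evalAt_add`), and its coefficients are values, at a tuple which is
smaller for the well-founded relation, of series `∑ (γᵢ - e choose j) c_γ x ^ γ`. These are again
in the image of `T`, by closure under renormalized derivatives. The division by `xᵢ ^ j` in the
Taylor formula is the reason to carry along the exponents `e` in `FunctionFamily.evalAt`.

*Inverses* (`FunctionFamily.inv_mem_coreRing`). They are covered by the same argument, applied to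
the constant series in one variable and `e = 1`.

The o-minimality of `K` enters only through the uniqueness of power functions with a given exponent
(`FunctionFamily.IsPowerWithExponent.extendPos_eq`), from which the identity
`k ^ (a + 1) = k * k ^ a` follows.
-/

noncomputable section

/-! ### Fragments and truncations of generalized series -/

namespace HahnSeries

section Fragment

variable {G R : Type*} [PartialOrder G]

theorem coeff_fragment_of_mem [Zero R] (f : HahnSeries G R) {S : Set G} {g : G} (h : g ∈ S) :
    (f.fragment S).coeff g = f.coeff g := by
  simp [fragment, h]

theorem coeff_fragment_of_notMem [Zero R] (f : HahnSeries G R) {S : Set G} {g : G} (h : g ∉ S) :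
    (f.fragment S).coeff g = 0 := by
  simp [fragment, h]

theorem mem_support_fragment [Zero R] (f : HahnSeries G R) {S : Set G} {g : G} :
    g ∈ (f.fragment S).support ↔ g ∈ S ∧ g ∈ f.support := by
  by_cases h : g ∈ S <;>
    simp [h, coeff_fragment_of_mem, coeff_fragment_of_notMem]

theorem fragment_eq_self [Zero R] {f : HahnSeries G R} {S : Set G} (h : f.support ⊆ S) :
    f.fragment S = f := by
  ext g
  by_cases hg : g ∈ S
  · rw [coeff_fragment_of_mem f hg]
  · rw [coeff_fragment_of_notMem f hg]
    by_contra h'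
    exact hg (h (Ne.symm h'))

theorem fragment_fragment [Zero R] (f : HahnSeries G R) (S T : Set G) :
    (f.fragment S).fragment T = f.fragment (S ∩ T) := by
  ext g
  by_cases hS : g ∈ S <;> by_cases hT : g ∈ T <;>
    simp [hS, hT, coeff_fragment_of_mem, coeff_fragment_of_notMem]

theorem fragment_congr [Zero R] {f : HahnSeries G R} {S T : Set G}
    (h : ∀ g ∈ f.support, g ∈ S ↔ g ∈ T) : f.fragment S = f.fragment T := by
  ext g
  by_cases hg : f.coeff g = 0
  · simp [fragment, hg]
  · by_cases hS : g ∈ S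
    · rw [coeff_fragment_of_mem f hS, coeff_fragment_of_mem f ((h g hg).1 hS)]
    · rw [coeff_fragment_of_notMem f hS, coeff_fragment_of_notMem f fun hT => hS ((h g hg).2 hT)]

theorem fragment_add_fragment_compl [AddMonoid R] (f : HahnSeries G R) (S : Set G) :
    f.fragment S + f.fragment Sᶜ = f := by
  ext g
  by_cases hS : g ∈ S <;> simp [hS, coeff_fragment_of_mem, coeff_fragment_of_notMem]

theorem coeff_truncation_of_lt [Zero R] (f : HahnSeries G R) {g h : G} (hh : h < g) :
    (f.truncation g).coeff h = f.coeff h :=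
  f.coeff_fragment_of_mem hh

theorem coeff_truncation_of_not_lt [Zero R] (f : HahnSeries G R) {g h : G} (hh : ¬ h < g) :
    (f.truncation g).coeff h = 0 :=
  f.coeff_fragment_of_notMem hh

theorem mem_support_truncation [Zero R] (f : HahnSeries G R) {g h : G} :
    h ∈ (f.truncation g).support ↔ h < g ∧ h ∈ f.support :=
  f.mem_support_fragment

theorem truncation_eq_self [Zero R] {f : HahnSeries G R} {g : G} (h : ∀ a ∈ f.support, a < g) :
    f.truncation g = f :=
  fragment_eq_self h

theorem truncation_congr [Zero R] {f f' : HahnSeries G R} {g : G}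
    (h : ∀ a < g, f.coeff a = f'.coeff a) : f.truncation g = f'.truncation g := by
  ext a
  by_cases ha : a < g
  · rw [coeff_truncation_of_lt f ha, coeff_truncation_of_lt f' ha, h a ha]
  · rw [coeff_truncation_of_not_lt f ha, coeff_truncation_of_not_lt f' ha]

theorem truncation_eq_zero [Zero R] {f : HahnSeries G R} {g : G} (h : ∀ a < g, f.coeff a = 0) :
    f.truncation g = 0 := by
  ext a
  by_cases ha : a < g
  · rw [coeff_truncation_of_lt f ha, h a ha, coeff_zero]
  · rw [coeff_truncation_of_not_lt f ha, coeff_zero]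

@[simp]
theorem truncation_zero [Zero R] (g : G) : (0 : HahnSeries G R).truncation g = 0 :=
  truncation_eq_zero fun _ _ => rfl

theorem truncation_add [AddMonoid R] (f f' : HahnSeries G R) (g : G) :
    (f + f').truncation g = f.truncation g + f'.truncation g := by
  ext a
  by_cases ha : a < g <;> simp [coeff_truncation_of_lt, coeff_truncation_of_not_lt, ha]

theorem truncation_neg [AddGroup R] (f : HahnSeries G R) (g : G) :
    (-f).truncation g = -f.truncation g := by
  ext a
  by_cases ha : a < g <;> simp [coeff_truncation_of_lt, coeff_truncation_of_not_lt, ha]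

theorem truncation_sub [AddGroup R] (f f' : HahnSeries G R) (g : G) :
    (f - f').truncation g = f.truncation g - f'.truncation g := by
  rw [sub_eq_add_neg, truncation_add, truncation_neg, sub_eq_add_neg]

theorem coeff_sub_truncation_of_lt [AddGroup R] (f : HahnSeries G R) {g h : G} (hh : h < g) :
    (f - f.truncation g).coeff h = 0 := by
  rw [coeff_sub, coeff_truncation_of_lt f hh, sub_self]

end Fragment

section LinearOrder

variable {Γ R : Type*} [LinearOrder Γ]

theorem truncation_single [Zero R] (a g : Γ) (r : R) :
    (single a r).truncation g = single a r ∨ (single a r).truncation g = 0 := by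
  by_cases h : a < g
  · exact Or.inl (truncation_eq_self fun b hb => eq_of_mem_support_single hb ▸ h)
  · refine Or.inr (truncation_eq_zero fun b hb => coeff_single_of_ne ?_)
    rintro rfl
    exact h hb

theorem truncation_truncation [Zero R] (f : HahnSeries Γ R) (g h : Γ) :
    (f.truncation g).truncation h = f.truncation (min g h) := by
  rw [truncation, truncation, fragment_fragment, Set.Iio_inter_Iio]
  rfl

/-- `a` is the truncation of `b` at one of the monomials of `b`. -/
def IsProperTruncation [Zero R] (a b : HahnSeries Γ R) : Prop :=
  ∃ p ∈ b.support, a = b.truncation p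

/-- As supports are well-ordered, recursion on proper truncations is possible. -/
theorem wellFounded_isProperTruncation [Zero R] :
    WellFounded (IsProperTruncation : HahnSeries Γ R → HahnSeries Γ R → Prop) := by
  refine ⟨fun b => ⟨b, ?_⟩⟩
  rintro _ ⟨p, hp, rfl⟩
  refine b.isWF_support.induction (P := fun p => Acc IsProperTruncation (b.truncation p)) hp
    fun p hp ih => ⟨_, ?_⟩
  rintro _ ⟨q, hq, rfl⟩
  obtain ⟨hqp, hq⟩ := b.mem_support_truncation.1 hq
  rw [truncation_truncation, min_eq_right hqp.le]
  exact ih q hq hqp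

end LinearOrder

section Ring

variable {Γ K : Type*} [AddCommGroup Γ] [LinearOrder Γ] [IsOrderedAddMonoid Γ]

theorem coeff_mul_eq_zero_of_lt [Semiring K] {y z : HahnSeries Γ K} {p q g : Γ}
    (hy : ∀ a < p, y.coeff a = 0) (hz : ∀ a < q, z.coeff a = 0) (hg : g < p + q) :
    (y * z).coeff g = 0 := by
  by_contra h
  obtain ⟨a, ha, b, hb, rfl⟩ := support_mul_subset h
  have h1 : p ≤ a := not_lt.1 fun h => ha (hy a h)
  have h2 : q ≤ b := not_lt.1 fun h => hb (hz b h)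
  exact absurd hg (not_lt.2 (add_le_add h1 h2))

theorem coeff_pow_eq_zero_of_lt [Semiring K] {y : HahnSeries Γ K} {p : Γ}
    (hy : ∀ a < p, y.coeff a = 0) (N : ℕ) : ∀ g < N • p, (y ^ N).coeff g = 0 := by
  induction N with
  | zero =>
    intro g hg
    rw [zero_nsmul] at hg
    simp [coeff_one, hg.ne]
  | succ N ih =>
    intro g hg
    rw [succ_nsmul] at hg
    rw [pow_succ]
    exact coeff_mul_eq_zero_of_lt ih hy hg

variable [Field K] (R : Subfield (HahnSeries Γ K))

/-- The elements of a set of generalized series all of whose truncations lie in that set: the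
largest truncation-closed subset. -/
def truncationCore {Γ K : Type*} [LinearOrder Γ] [Zero K] (R : Set (HahnSeries Γ K)) :
    Set (HahnSeries Γ K) :=
  {y | y ∈ R ∧ ∀ g, y.truncation g ∈ R}

theorem truncation_mem_truncationCore {Γ K : Type*} [LinearOrder Γ] [Zero K]
    {R : Set (HahnSeries Γ K)} {y : HahnSeries Γ K} (hy : y ∈ truncationCore R) (g : Γ) :
    y.truncation g ∈ truncationCore R :=
  ⟨hy.2 g, fun h => by rw [truncation_truncation]; exact hy.2 _⟩

/-- The product of two series all of whose truncations lie in `R` has the same property. For `p`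
in the support of `y` and `q` in that of `z` with `g ≤ p + q`, the product of `y - y|p` and
`z - z|q` has no terms with exponent `< g`, which reduces `(y * z)|g` to products with a factor of
smaller length; if there are no such `p` and `q`, there is nothing to truncate. -/
theorem truncation_mul_mem (y : HahnSeries Γ K) :
    ∀ z, y ∈ truncationCore (R : Set (HahnSeries Γ K)) →
      z ∈ truncationCore (R : Set (HahnSeries Γ K)) → ∀ g, (y * z).truncation g ∈ R := by
  induction y using wellFounded_isProperTruncation.induction with
  | _ y ihy =>
  intro z
  induction z using wellFounded_isProperTruncation.induction with
  | _ z ihz =>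
  intro hy hz g
  by_cases h : ∃ p ∈ y.support, ∃ q ∈ z.support, g ≤ p + q
  · obtain ⟨p, hp, q, hq, hg⟩ := h
    have key : (y * z).truncation g = (y.truncation p * z + y * z.truncation q
        - y.truncation p * z.truncation q).truncation g := by
      refine truncation_congr fun a ha => ?_
      rw [← sub_eq_zero, ← coeff_sub]
      have : y * z - (y.truncation p * z + y * z.truncation q
          - y.truncation p * z.truncation q) = (y - y.truncation p) * (z - z.truncation q) := by
        ring
      rw [this]
      exact coeff_mul_eq_zero_of_lt (fun b hb => y.coeff_sub_truncation_of_lt hb)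
        (fun b hb => z.coeff_sub_truncation_of_lt hb) (ha.trans_le hg)
    rw [key, truncation_sub, truncation_add]
    have hyp := truncation_mem_truncationCore hy p
    have hzq := truncation_mem_truncationCore hz q
    exact sub_mem (add_mem (ihy _ ⟨p, hp, rfl⟩ z hyp hz g) (ihz _ ⟨q, hq, rfl⟩ hy hzq g))
      (ihy _ ⟨p, hp, rfl⟩ _ hyp hzq g)
  · push Not at h
    rw [truncation_eq_self]
    · exact mul_mem hy.1 hz.1
    · intro a ha
      obtain ⟨p, hp, q, hq, rfl⟩ := support_mul_subset ha
      exact h p hp q hq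

theorem single_mem_truncationCore {a : Γ} {r : K} (h : single a r ∈ R) :
    single a r ∈ truncationCore (R : Set (HahnSeries Γ K)) := by
  refine ⟨h, fun g => ?_⟩
  rcases truncation_single a g r with h' | h' <;> rw [h']
  · exact h
  · exact zero_mem R

/-- The ring of the elements of a field of generalized series all of whose truncations lie in that
field. -/
def coreRing : Subring (HahnSeries Γ K) where
  carrier := truncationCore R
  mul_mem' hy hz := ⟨mul_mem hy.1 hz.1, truncation_mul_mem R _ _ hy hz⟩
  add_mem' hy hz := ⟨add_mem hy.1 hz.1, fun g => by
    rw [truncation_add]; exact add_mem (hy.2 g) (hz.2 g)⟩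
  neg_mem' hy := ⟨neg_mem hy.1, fun g => by rw [truncation_neg]; exact neg_mem (hy.2 g)⟩
  zero_mem' := ⟨zero_mem R, fun g => by rw [truncation_zero]; exact zero_mem R⟩
  one_mem' := single_mem_truncationCore R (one_mem R)

variable {R}

theorem truncation_mem_coreRing {y : HahnSeries Γ K} (hy : y ∈ coreRing R) (g : Γ) :
    y.truncation g ∈ coreRing R :=
  truncation_mem_truncationCore hy g

/-- The leading term of an element of `coreRing R` is one of its truncations, unless it is the
whole series. -/
theorem leadingTerm_mem {y : HahnSeries Γ K} (hy : y ∈ coreRing R) :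
    single y.order y.leadingCoeff ∈ R := by
  by_cases h : y = single y.order y.leadingCoeff
  · rw [← h]
    exact hy.1
  · have hd : y - single y.order y.leadingCoeff ≠ 0 := sub_ne_zero.2 h
    set d := y - single y.order y.leadingCoeff with hd_def
    have hord : y.order < d.order := by
      have hle : ∀ a ∈ d.support, y.order < a := by
        intro a ha
        refine lt_of_le_of_ne (not_lt.1 fun hlt => ha ?_) ?_
        · rw [hd_def, coeff_sub, coeff_eq_zero_of_lt_order hlt, coeff_single_of_ne hlt.ne, sub_zero]
        · rintro rfl
          exact ha (by rw [hd_def, coeff_sub, coeff_single_same, leadingCoeff_eq, sub_self])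
      exact hle _ (by simpa [coeff_order_eq_zero] using hd)
    suffices heq : single y.order y.leadingCoeff = y.truncation d.order by
      rw [heq]
      exact hy.2 d.order
    ext a
    by_cases ha : a < d.order
    · rw [coeff_truncation_of_lt y ha, ← sub_eq_zero, ← coeff_sub, ← neg_eq_zero, ← coeff_neg,
        neg_sub, ← hd_def, coeff_eq_zero_of_lt_order ha]
    · rw [coeff_truncation_of_not_lt y ha, coeff_single_of_ne]
      rintro rfl
      exact ha hord

end Ring

end HahnSeries

/-! ### Binomial series and their evaluation at infinitesimal Hahn series -/

section BinomialPower

variable {K : Type u} [Field K]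

@[simp]
theorem genBinom_zero_right (a : K) : genBinom a 0 = 1 := by
  simp [genBinom]

theorem genBinom_succ [CharZero K] (a : K) (m : ℕ) :
    genBinom a (m + 1) = genBinom a m * (a - m) / (m + 1) := by
  rw [genBinom, genBinom, Finset.prod_range_succ, Nat.factorial_succ, Nat.cast_mul, Nat.cast_succ]
  have h1 : (m.factorial : K) ≠ 0 := by exact_mod_cast m.factorial_ne_zero
  have h2 : (m : K) + 1 ≠ 0 := Nat.cast_add_one_ne_zero m
  field_simp

theorem genBinom_zero_left {m : ℕ} (hm : m ≠ 0) : genBinom (0 : K) m = 0 := by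
  rw [genBinom, Finset.prod_eq_zero (i := 0) (by simpa using Nat.pos_of_ne_zero hm) (by simp),
    zero_div]

/-- Pascal's rule. -/
theorem genBinom_add_one_succ [CharZero K] (a : K) (m : ℕ) :
    genBinom (a + 1) (m + 1) = genBinom a (m + 1) + genBinom a m := by
  rw [genBinom_succ a, genBinom, genBinom, Finset.prod_range_succ', Nat.factorial_succ,
    Nat.cast_mul, Nat.cast_succ]
  have h1 : (m.factorial : K) ≠ 0 := by exact_mod_cast m.factorial_ne_zero
  have h2 : (m : K) + 1 ≠ 0 := Nat.cast_add_one_ne_zero m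
  have h3 : ∀ j ∈ Finset.range m, a + 1 - ((j + 1 : ℕ) : K) = a - j := fun j _ => by
    push_cast; ring
  rw [Finset.prod_congr rfl h3]
  field_simp
  push_cast
  ring

theorem genBinom_mul_choose [CharZero K] (a : K) (i j : ℕ) :
    ((i + j).choose j : K) * genBinom a (i + j) = genBinom a j * genBinom (a - j) i := by
  have h0 : ((i + j).choose j : K) = (i + j).factorial / (i.factorial * j.factorial) := by
    rw [Nat.cast_choose K (Nat.le_add_left j i), Nat.add_sub_cancel, mul_comm (j.factorial : K)]
  have h1 : ((i + j).factorial : K) ≠ 0 := by exact_mod_cast (i + j).factorial_ne_zero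
  have h2 : (i.factorial : K) ≠ 0 := by exact_mod_cast i.factorial_ne_zero
  have h3 : (j.factorial : K) ≠ 0 := by exact_mod_cast j.factorial_ne_zero
  rw [h0, genBinom, genBinom, genBinom, add_comm i j, Finset.prod_range_add]
  rw [add_comm i j] at h1
  have h4 : ∀ x ∈ Finset.range i, a - ((j + x : ℕ) : K) = a - j - x := fun x _ => by
    push_cast; ring
  rw [Finset.prod_congr rfl h4]
  field_simp

/-- The expansion `∑ₘ (a choose m) k ^ (a - m) X ^ m` of `(k + X) ^ a`, where `pw` is the function
`a ↦ k ^ a`. -/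
def binomialPower (pw : K → K) (a : K) : PowerSeries K :=
  PowerSeries.mk fun m => genBinom a m * pw (a - m)

variable {pw : K → K} {k : K}

theorem coeff_binomialPower (a : K) (m : ℕ) :
    PowerSeries.coeff m (binomialPower pw a) = genBinom a m * pw (a - m) := by
  rw [binomialPower, PowerSeries.coeff_mk]

theorem binomialPower_zero (h0 : pw 0 = 1) : binomialPower pw 0 = 1 := by
  ext m
  rw [coeff_binomialPower, PowerSeries.coeff_one]
  split_ifs with hm
  · simp [hm, h0]
  · rw [genBinom_zero_left hm, zero_mul]

theorem binomialPower_add_one [CharZero K] (h : ∀ a, pw (a + 1) = k * pw a) (a : K) :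
    binomialPower pw (a + 1) = (PowerSeries.C k + PowerSeries.X) * binomialPower pw a := by
  ext m
  cases m with
  | zero =>
    have hc : ∀ b, PowerSeries.constantCoeff (binomialPower pw b) = pw b := fun b => by
      simp [← PowerSeries.coeff_zero_eq_constantCoeff_apply, coeff_binomialPower]
    simp [hc, h]
  | succ m =>
    rw [add_mul, map_add, PowerSeries.coeff_C_mul, PowerSeries.coeff_succ_X_mul,
      coeff_binomialPower, coeff_binomialPower, coeff_binomialPower, genBinom_add_one_succ]
    have h1 : a + 1 - ((m + 1 : ℕ) : K) = a - ((m + 1 : ℕ) : K) + 1 := by ring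
    have h2 : a - (m : K) = a - ((m + 1 : ℕ) : K) + 1 := by push_cast; ring
    rw [h1, h2, h]
    ring

theorem binomialPower_sub_mul_pow [CharZero K] (h : ∀ a, pw (a + 1) = k * pw a) (a : K) (e : ℕ) :
    binomialPower pw (a - e) * (PowerSeries.C k + PowerSeries.X) ^ e = binomialPower pw a := by
  induction e with
  | zero => simp
  | succ e ih =>
    rw [← ih, pow_succ', ← mul_assoc, mul_comm (binomialPower pw _), ← binomialPower_add_one h]
    congr 3
    push_cast
    ring

/-- The divided derivatives of the expansion of `(k + X) ^ a` are multiples of those of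
`(k + X) ^ (a - j)`. -/
theorem choose_mul_coeff_binomialPower [CharZero K] (a : K) (i j : ℕ) :
    ((i + j).choose j : K) * PowerSeries.coeff (i + j) (binomialPower pw a) =
      genBinom a j * PowerSeries.coeff i (binomialPower pw (a - j)) := by
  rw [coeff_binomialPower, coeff_binomialPower, ← mul_assoc, genBinom_mul_choose, mul_assoc]
  congr 3
  push_cast
  ring

end BinomialPower

namespace HahnSeries

section Taylor

variable {Γ K : Type*} [AddCommGroup Γ] [LinearOrder Γ] [IsOrderedAddMonoid Γ] [Field K]

theorem support_prod_subset {ι : Type*} (t : Finset ι) (f : ι → HahnSeries Γ K)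
    (M : AddSubmonoid Γ) (h : ∀ i ∈ t, (f i).support ⊆ M) : (∏ i ∈ t, f i).support ⊆ M := by
  classical
  induction t using Finset.induction_on with
  | empty =>
    rw [Finset.prod_empty, support_one, Set.singleton_subset_iff]
    exact zero_mem _
  | insert i t hi ih =>
    rw [Finset.prod_insert hi]
    intro g hg
    obtain ⟨a, ha, b, hb, rfl⟩ := support_mul_subset hg
    exact add_mem (h i (Finset.mem_insert_self _ _) ha)
      (ih (fun j hj => h j (Finset.mem_insert_of_mem hj)) hb)

theorem support_heval_subset (y : HahnSeries Γ K) (f : PowerSeries K) :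
    (PowerSeries.heval y f).support ⊆ AddSubmonoid.closure y.support := by
  intro g hg
  rw [mem_support, PowerSeries.coeff_heval] at hg
  obtain ⟨m, hm⟩ := not_forall.1 fun h => hg (finsum_eq_zero_of_forall_eq_zero h)
  simp only [SummableFamily.coeff_apply, SummableFamily.smulFamily_toFun,
    SummableFamily.powers_toFun, coeff_smul, smul_eq_mul] at hm
  have hm := right_ne_zero_of_mul hm
  split_ifs at hm
  · exact SummableFamily.support_pow_subset_closure y m hm
  · have := SummableFamily.support_pow_subset_closure 0 m hm
    rw [support_zero, AddSubmonoid.closure_empty] at this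
    rw [show g = 0 from this]
    exact zero_mem _

/-- Taylor expansion of a power series at `a + δ` around `a`, up to terms divisible by `δ ^ N`;
here `h j` is the `j`-th divided derivative of `f`. -/
theorem coeff_heval_add {a δ : HahnSeries Γ K} (ha : 0 < a.orderTop) (hδ : 0 < δ.orderTop) {p : Γ}
    (hp : 0 < p) (hδp : ∀ b < p, δ.coeff b = 0) {N : ℕ} {g : Γ} (hg : g < N • p)
    (f : PowerSeries K) (h : ℕ → PowerSeries K)
    (hf : ∀ i j, PowerSeries.coeff i (h j) = ((i + j).choose j : K) * PowerSeries.coeff (i + j) f) :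
    (PowerSeries.heval (a + δ) f).coeff g =
      ∑ j ∈ Finset.range N, (PowerSeries.heval a (h j) * δ ^ j).coeff g := by
  classical
  have hfin : {q : ℕ × ℕ | (a ^ q.1 * δ ^ q.2).coeff g ≠ 0}.Finite := by
    have := ((SummableFamily.powers a).mul (SummableFamily.powers δ)).finite_co_support g
    simpa [ha, hδ, Function.HasFiniteSupport, Function.support] using this
  set S := hfin.toFinset with hS
  have hmem : ∀ q : ℕ × ℕ, q ∈ S ↔ (a ^ q.1 * δ ^ q.2).coeff g ≠ 0 := fun q => by simp [hS]
  set c : ℕ × ℕ → K := fun q => ((q.1 + q.2).choose q.2 : K) *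
    PowerSeries.coeff (q.1 + q.2) f * (a ^ q.1 * δ ^ q.2).coeff g with hc
  have hcS : ∀ q ∉ S, c q = 0 := fun q hq => by
    rw [hmem, not_not] at hq
    simp only [hc, hq, mul_zero]
  have hadd : 0 < (a + δ).orderTop := (lt_min ha hδ).trans_le min_orderTop_le_orderTop_add
  trans ∑ q ∈ S, c q
  · have hterm : ∀ m, PowerSeries.coeff m f * ((a + δ) ^ m).coeff g =
        ∑ q ∈ S with q.1 + q.2 = m, c q := by
      intro m
      rw [(Commute.all a δ).add_pow', coeff_sum, Finset.mul_sum]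
      have h1 : ∀ q ∈ Finset.HasAntidiagonal.antidiagonal m, PowerSeries.coeff m f *
          (m.choose q.1 • (a ^ q.1 * δ ^ q.2)).coeff g = c q := by
        rintro ⟨i, j⟩ hq
        obtain rfl := Finset.HasAntidiagonal.mem_antidiagonal.1 hq
        rw [coeff_nsmul, Pi.smul_apply, nsmul_eq_mul, hc, Nat.choose_symm_add]
        ring
      rw [Finset.sum_congr rfl h1]
      symm
      apply Finset.sum_subset
      · intro q hq
        simpa using (Finset.mem_filter.1 hq).2
      · intro q hq hq'
        apply hcS
        intro hqS
        exact hq' (Finset.mem_filter.2 ⟨hqS, Finset.HasAntidiagonal.mem_antidiagonal.1 hq⟩)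
    rw [PowerSeries.coeff_heval]
    have h2 : ∀ m, (SummableFamily.powerSeriesFamily (a + δ) f).coeff g m =
        ∑ q ∈ S with q.1 + q.2 = m, c q := fun m => by
      rw [← hterm]
      simp [hadd]
    rw [finsum_congr h2, finsum_eq_sum_of_support_subset (s := S.image fun q => q.1 + q.2)]
    · exact Finset.sum_fiberwise_of_maps_to (fun q hq => Finset.mem_image_of_mem _ hq) _
    · intro m hm
      obtain ⟨q, hq, -⟩ := Finset.exists_ne_zero_of_sum_ne_zero hm
      rw [Finset.mem_filter] at hq
      exact Finset.mem_coe.2 (Finset.mem_image.2 ⟨q, hq⟩)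
  · have hmaps : ∀ q ∈ S, q.2 ∈ Finset.range N := by
      intro q hq
      rw [hmem] at hq
      by_contra hN
      rw [Finset.mem_range, not_lt] at hN
      refine hq (coeff_mul_eq_zero_of_lt (p := 0) (q := q.2 • p) (fun b hb => ?_)
        (coeff_pow_eq_zero_of_lt hδp q.2) ?_)
      · refine (coeff_pow_eq_zero_of_lt (p := 0) (fun b hb => ?_) q.1) b (by simpa using hb)
        exact coeff_eq_zero_of_lt_orderTop ((WithTop.coe_lt_coe.2 hb).trans ha)
      · rw [zero_add]
        exact hg.trans_le (nsmul_le_nsmul_left hp.le hN)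
    rw [← Finset.sum_fiberwise_of_maps_to hmaps]
    refine Finset.sum_congr rfl fun j _ => ?_
    have h3 : (PowerSeries.heval a (h j) * δ ^ j) =
        (δ ^ j • SummableFamily.powerSeriesFamily a (h j)).hsum := by
      rw [SummableFamily.hsum_smul, mul_comm, PowerSeries.heval_apply]
    have h4 : ∀ i, ((δ ^ j • SummableFamily.powerSeriesFamily a (h j)) i).coeff g = c (i, j) := by
      intro i
      rw [SummableFamily.smul_apply]
      simp only [SummableFamily.smulFamily_toFun, SummableFamily.powers_toFun, ha, if_true, hf, hc]
      rw [of_symm_smul_of_eq_mul, mul_smul_comm, coeff_smul, smul_eq_mul, mul_comm (δ ^ j)]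
    rw [h3, SummableFamily.coeff_hsum, finsum_congr h4,
      finsum_eq_sum_of_support_subset (s := (S.filter fun q => q.2 = j).image Prod.fst)]
    · rw [Finset.sum_image]
      · refine Finset.sum_congr rfl fun q hq => ?_
        rw [← (Finset.mem_filter.1 hq).2]
      · rintro ⟨i, j'⟩ hq ⟨i', j''⟩ hq' (rfl : i = i')
        rw [Prod.mk.injEq]
        exact ⟨rfl, (Finset.mem_filter.1 hq).2.trans (Finset.mem_filter.1 hq').2.symm⟩
    · intro i hi
      have : (i, j) ∈ S := by
        by_contra hS'
        exact hi (hcS _ hS')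
      exact Finset.mem_coe.2 (Finset.mem_image.2 ⟨(i, j), by simpa using this, rfl⟩)

/-- Finite products of summable families. -/
theorem exists_summableFamily_pi {ι : Type*} : ∀ {n : ℕ} (s : Fin n → SummableFamily Γ K ι),
    ∃ t : SummableFamily Γ K (Fin n → ι),
      (∀ m, t m = ∏ i, s i (m i)) ∧ t.hsum = ∏ i, (s i).hsum
  | 0, s => ⟨SummableFamily.const _ 1, fun m => by simp, by simp⟩
  | n + 1, s => by
    obtain ⟨t, ht, hs⟩ := exists_summableFamily_pi fun i : Fin n => s i.succ
    refine ⟨SummableFamily.Equiv (Fin.consEquiv fun _ => ι) ((s 0).mul t), fun m => ?_, ?_⟩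
    · rw [Fin.prod_univ_succ, SummableFamily.Equiv_toFun, SummableFamily.mul_toFun, ht]
      rfl
    · rw [SummableFamily.hsum_equiv, SummableFamily.hsum_mul, hs, Fin.prod_univ_succ]

end Taylor

end HahnSeries

/-! ### Evaluation of generalized power series at infinitesimals -/

namespace HahnSeries

theorem hahnSum_coe {G R ι : Type*} [PartialOrder G] [AddCommMonoid R]
    (s : SummableFamily G R ι) : hahnSum s = s.hsum := by
  rw [hahnSum, dif_pos ⟨s.isPWO_iUnion_support, s.finite_co_support⟩]
  rfl

theorem SummableFamily.sum_apply {G R ι α : Type*} [PartialOrder G] [AddCommMonoid R]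
    (t : Finset ι) (s : ι → SummableFamily G R α) (a : α) :
    (∑ i ∈ t, s i) a = ∑ i ∈ t, s i a := by
  classical
  induction t using Finset.induction_on with
  | empty => rfl
  | insert i t hi ih => rw [Finset.sum_insert hi, Finset.sum_insert hi, add_apply, ih]

/-- Truncating one entry of a tuple at one of its monomials is a well-founded operation. -/
theorem wellFounded_update_isProperTruncation {Γ R : Type*} [LinearOrder Γ] [Zero R] {n : ℕ} :
    WellFounded fun ε' ε : Fin n → HahnSeries Γ R =>
      ∃ i a, IsProperTruncation a (ε i) ∧ ε' = Function.update ε i a := by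
  have hwf : IsWellFounded (HahnSeries Γ R) IsProperTruncation := ⟨wellFounded_isProperTruncation⟩
  refine Subrelation.wf ?_ (InvImage.wf (fun (ε : Fin n → HahnSeries Γ R) i =>
    IsWellFounded.rank IsProperTruncation (ε i)) wellFounded_lt)
  rintro _ ε ⟨i, a, ha, rfl⟩
  refine Pi.lt_def.2 ⟨fun j => ?_, i, ?_⟩
  · by_cases hj : j = i
    · subst hj
      simpa using (IsWellFounded.rank_lt_of_rel ha).le
    · simp [hj]
  · simpa using IsWellFounded.rank_lt_of_rel ha

theorem isPWO_closure_support {Γ R : Type*} [AddCommGroup Γ] [LinearOrder Γ]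
    [IsOrderedAddMonoid Γ] [Zero R] {n : ℕ} {ε : Fin n → HahnSeries Γ R}
    (hε : ∀ i, 0 < (ε i).orderTop) :
    (AddSubmonoid.closure (⋃ i, (ε i).support) : Set Γ).IsPWO := by
  refine Set.IsPWO.addSubmonoid_closure (fun g hg => ?_) ?_
  · obtain ⟨i, hi⟩ := Set.mem_iUnion.1 hg
    exact WithTop.coe_le_coe.1 ((hε i).le.trans (orderTop_le_of_coeff_ne_zero hi))
  · have := (Finset.isPWO_sup Finset.univ (f := fun i => (ε i).support)).2
      fun i _ => (ε i).isPWO_support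
    simpa using this

end HahnSeries

namespace FunctionFamily

open HahnSeries

variable {K : Type u} [Field K] [LinearOrder K] [IsStrictOrderedRing K] {L : FunctionFamily K}
  {Γ : Type v} [AddCommGroup Γ] [LinearOrder Γ] {n : ℕ}

section PowerProd

variable [IsOrderedAddMonoid Γ]

/-- The product of the powers `(kᵢ + εᵢ) ^ (γᵢ - eᵢ)`, where `pw i` is the function
`a ↦ kᵢ ^ a`. -/
def powerProd (pw : Fin n → K → K) (ε : Fin n → HahnSeries Γ K) (e : Fin n → ℕ)
    (γ : Fin n → L.exponents) : HahnSeries Γ K :=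
  ∏ i, PowerSeries.heval (ε i) (binomialPower (pw i) ((γ i : K) - e i))

theorem support_powerProd_subset (pw : Fin n → K → K) (ε : Fin n → HahnSeries Γ K)
    (e : Fin n → ℕ) (γ : Fin n → L.exponents) :
    (powerProd pw ε e γ).support ⊆ AddSubmonoid.closure (⋃ i, (ε i).support) := by
  exact support_prod_subset _ _ _ fun i _ => (support_heval_subset _ _).trans
    (AddSubmonoid.closure_mono (Set.subset_iUnion (fun i => (ε i).support) i))

end PowerProd

variable [Module L.exponents Γ]

/-- The exponent `∑ γᵢ vᵢ` of the monomial which is obtained by substituting `t ^ vᵢ` for the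
`i`-th variable in the monomial `x ^ γ`. -/
def weight (v : Fin n → Γ) (γ : Fin n → L.exponents) : Γ :=
  ∑ i, γ i • v i

section Weight

variable [IsOrderedAddMonoid Γ] [IsStrictOrderedModule L.exponents Γ] {v : Fin n → Γ}

theorem weight_strictMono (hv : ∀ i, 0 < v i) :
    StrictMono (weight v : (Fin n → L.exponents) → Γ) := by
  intro γ γ' h
  obtain ⟨hle, i, hi⟩ := Pi.lt_def.1 h
  exact Finset.sum_lt_sum (fun j _ => smul_le_smul_of_nonneg_right (hle j) (hv j).le)
    ⟨i, Finset.mem_univ i, smul_lt_smul_of_pos_right hi (hv i)⟩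

theorem isPWO_weight_image (hv : ∀ i, 0 < v i) (F : L.Series n) :
    (weight v '' F.support).IsPWO :=
  F.isPWO_support.image_of_monotone (weight_strictMono hv).monotone

/-- The elements of a support of a given weight form an antichain, so that there are only finitely
many of them. -/
theorem finite_weight_eq (hv : ∀ i, 0 < v i) (F : L.Series n) (d : Γ) :
    {γ | γ ∈ F.support ∧ weight v γ = d}.Finite := by
  refine IsAntichain.finite_of_partiallyWellOrderedOn (r := (· ≤ ·)) ?_
    (F.isPWO_support.mono fun γ hγ => hγ.1)
  intro γ hγ γ' hγ' hne hle
  exact (weight_strictMono hv (lt_of_le_of_ne hle hne)).ne (hγ.2.trans hγ'.2.symm)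

/-- Summability of `c_γ t ^ (∑ γᵢ vᵢ) W_{γ,m}` over all `γ` and `m`, if the series `W_{γ,m}` have
their supports in a common well-ordered set and are summable for fixed `γ`. -/
theorem summable_weighted (hv : ∀ i, 0 < v i) {ι : Type*} (F : L.Series n)
    (W : (Fin n → L.exponents) → ι → HahnSeries Γ K) {S : Set Γ} (hS : S.IsPWO)
    (hWS : ∀ γ m, (W γ m).support ⊆ S)
    (hfin : ∀ γ g, {m | (W γ m).coeff g ≠ 0}.Finite) :
    (⋃ p : (Fin n → L.exponents) × ι,
      (single (weight v p.1) (F.coeff p.1) * W p.1 p.2).support).IsPWO ∧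
    ∀ g, {p : (Fin n → L.exponents) × ι |
      (single (weight v p.1) (F.coeff p.1) * W p.1 p.2).coeff g ≠ 0}.Finite := by
  have key : ∀ (p : (Fin n → L.exponents) × ι) (g : Γ),
      (single (weight v p.1) (F.coeff p.1) * W p.1 p.2).coeff g ≠ 0 →
      p.1 ∈ F.support ∧ ∃ s ∈ S, (W p.1 p.2).coeff s ≠ 0 ∧ weight v p.1 + s = g := by
    intro p g hg
    rw [coeff_single_mul] at hg
    exact ⟨left_ne_zero_of_mul hg, g - weight v p.1, hWS _ _ (right_ne_zero_of_mul hg),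
      right_ne_zero_of_mul hg, add_sub_cancel _ _⟩
  have hD := isPWO_weight_image hv F
  refine ⟨(hD.add hS).mono fun g hg => ?_, fun g => ?_⟩
  · obtain ⟨p, hp⟩ := Set.mem_iUnion.1 hg
    obtain ⟨h1, s, hs, -, rfl⟩ := key p g hp
    exact Set.add_mem_add ⟨_, h1, rfl⟩ hs
  · refine Set.Finite.subset ((Finset.antidiagonal hD hS g).finite_toSet.biUnion fun ds _ =>
      (finite_weight_eq hv F ds.1).biUnion fun γ _ => (hfin γ ds.2).image fun m => (γ, m)) ?_
    intro p hp
    obtain ⟨h1, s, hs, h2, h3⟩ := key p g hp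
    simp only [Set.mem_iUnion]
    refine ⟨(weight v p.1, s), ?_, p.1, ⟨h1, rfl⟩, p.2, h2, rfl⟩
    exact Finset.mem_coe.2 (Finset.mem_antidiagonal.2 ⟨⟨_, h1, rfl⟩, hs, h3⟩)

end Weight

section EvalAt

variable [IsOrderedAddMonoid Γ]

/-- The value `∑ c_γ t ^ (∑ γᵢ vᵢ) ∏ (kᵢ + εᵢ) ^ (γᵢ - eᵢ)` for `F = ∑ c_γ x ^ γ`. For `e = 0`, this
is `F` evaluated at the elements `t ^ vᵢ (kᵢ + εᵢ)`. -/
def evalAt (pw : Fin n → K → K) (v : Fin n → Γ) (ε : Fin n → HahnSeries Γ K) (e : Fin n → ℕ)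
    (F : L.Series n) : HahnSeries Γ K :=
  hahnSum fun γ => single (weight v γ) (F.coeff γ) * powerProd pw ε e γ

variable [IsStrictOrderedModule L.exponents Γ]
  {pw : Fin n → K → K} {v : Fin n → Γ} {ε : Fin n → HahnSeries Γ K}

theorem exists_evalAt_family (pw : Fin n → K → K) (hv : ∀ i, 0 < v i)
    (hε : ∀ i, 0 < (ε i).orderTop) (e : Fin n → ℕ) (F : L.Series n) :
    ∃ s : SummableFamily Γ K (Fin n → L.exponents),
      (∀ γ, s γ = single (weight v γ) (F.coeff γ) * powerProd pw ε e γ) ∧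
      evalAt pw v ε e F = s.hsum := by
  obtain ⟨h1, h2⟩ := summable_weighted hv F (fun γ (_ : Unit) => powerProd pw ε e γ)
    (isPWO_closure_support hε) (fun γ _ => support_powerProd_subset pw ε e γ)
    fun γ g => Set.toFinite _
  let s : SummableFamily Γ K ((Fin n → L.exponents) × Unit) := ⟨_, h1, h2⟩
  refine ⟨SummableFamily.Equiv (Equiv.prodPUnit _) s, fun γ => rfl, ?_⟩
  rw [← hahnSum_coe]
  rfl

theorem evalAt_add (pw : Fin n → K → K) (hv : ∀ i, 0 < v i) (hε : ∀ i, 0 < (ε i).orderTop)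
    (e : Fin n → ℕ) (F G : L.Series n) :
    evalAt pw v ε e (F + G) = evalAt pw v ε e F + evalAt pw v ε e G := by
  obtain ⟨s, hs, h1⟩ := exists_evalAt_family pw hv hε e F
  obtain ⟨t, ht, h2⟩ := exists_evalAt_family pw hv hε e G
  obtain ⟨w, hw, h3⟩ := exists_evalAt_family pw hv hε e (F + G)
  rw [h1, h2, h3, ← SummableFamily.hsum_add]
  congr 1
  ext1 γ
  rw [SummableFamily.add_apply, hs, ht, hw, coeff_add, single_add, add_mul]

theorem exists_of_mem_support_evalAt (hv : ∀ i, 0 < v i) (hε : ∀ i, 0 < (ε i).orderTop)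
    {e : Fin n → ℕ} {F : L.Series n} {g : Γ} (hg : g ∈ (evalAt pw v ε e F).support) :
    ∃ γ ∈ F.support, ∃ s ∈ AddSubmonoid.closure (⋃ i, (ε i).support), weight v γ + s = g := by
  obtain ⟨s, hs, h1⟩ := exists_evalAt_family pw hv hε e F
  rw [h1] at hg
  obtain ⟨γ, hγ⟩ := Set.mem_iUnion.1 (SummableFamily.support_hsum_subset hg)
  rw [hs, mem_support, coeff_single_mul] at hγ
  exact ⟨γ, left_ne_zero_of_mul hγ, g - weight v γ,
    support_powerProd_subset pw ε e γ (right_ne_zero_of_mul hγ), add_sub_cancel _ _⟩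

/-- The exponents `e` amount to a division of the value of `F` by the powers `(kᵢ + εᵢ) ^ eᵢ`. -/
theorem evalAt_mul_prod_pow {k : Fin n → K} (hpw : ∀ i a, pw i (a + 1) = k i * pw i a)
    (hv : ∀ i, 0 < v i) (hε : ∀ i, 0 < (ε i).orderTop) (e : Fin n → ℕ) (F : L.Series n) :
    evalAt pw v ε e F * ∏ i, (C (k i) + ε i) ^ e i = evalAt pw v ε 0 F := by
  obtain ⟨s, hs, h1⟩ := exists_evalAt_family pw hv hε e F
  obtain ⟨t, ht, h2⟩ := exists_evalAt_family pw hv hε 0 F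
  rw [h1, h2, mul_comm, ← SummableFamily.hsum_smul]
  congr 1
  ext1 γ
  rw [SummableFamily.smul_apply, of_symm_smul_of_eq_mul, hs, ht, mul_comm, mul_assoc]
  congr 1
  rw [powerProd, powerProd, ← Finset.prod_mul_distrib]
  refine Finset.prod_congr rfl fun i _ => ?_
  have hX : C (k i) + ε i = PowerSeries.heval (ε i) (PowerSeries.C (k i) + PowerSeries.X) := by
    rw [map_add, PowerSeries.heval_X _ (hε i), PowerSeries.heval_C, ← C_mul_eq_smul, mul_one]
  rw [hX, ← map_pow, ← map_mul, binomialPower_sub_mul_pow (hpw i)]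
  simp

/-- The series `∑ (γᵢ - e choose j) c_γ x ^ γ`, i.e. the divided derivative
`xᵢ ^ (e + j) ∂ᵢ ^ j (xᵢ ^ (-e) F) / j!` of `F = ∑ c_γ x ^ γ`. -/
def eulerBinom (i : Fin n) (e j : ℕ) (F : L.Series n) : L.Series n where
  coeff γ := genBinom ((γ i : K) - e) j * F.coeff γ
  isPWO_support' := F.isPWO_support.mono fun γ hγ => by
    simp only [Function.mem_support, ne_eq] at hγ
    exact right_ne_zero_of_mul hγ

/-- Taylor expansion of the value of `F` in the `i`-th variable: if all monomials of `F` have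
weight at least `g - N p` and `p` is the order of `δ`, then derivatives of order `≥ N` do not
contribute to terms with exponent `< g`. -/
theorem coeff_evalAt_add (hv : ∀ i, 0 < v i) (hε : ∀ i, 0 < (ε i).orderTop) {i : Fin n}
    {a δ : HahnSeries Γ K} (ha : 0 < a.orderTop) (hδ : 0 < δ.orderTop) (hi : ε i = a + δ) {p : Γ}
    (hp : 0 < p) (hδp : ∀ b < p, δ.coeff b = 0) {N : ℕ} {g : Γ} {F : L.Series n}
    (hF : ∀ γ ∈ F.support, g ≤ weight v γ + N • p) (e : Fin n → ℕ) {g' : Γ} (hg' : g' < g) :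
    (evalAt pw v ε e F).coeff g' = (∑ j ∈ Finset.range N,
      evalAt pw v (Function.update ε i a) (e + Pi.single i j) (eulerBinom i (e i) j F) *
        δ ^ j).coeff g' := by
  have hε' : ∀ l, 0 < (Function.update ε i a l).orderTop := fun l => by
    by_cases hl : l = i
    · subst hl; simpa using ha
    · simpa [hl] using hε l
  obtain ⟨s, hs, h1⟩ := exists_evalAt_family pw hv hε e F
  choose t ht h2 using fun j => exists_evalAt_family pw hv hε' (e + Pi.single i j)
    (eulerBinom i (e i) j F)
  have hsum : evalAt pw v ε e F - ∑ j ∈ Finset.range N,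
      evalAt pw v (Function.update ε i a) (e + Pi.single i j) (eulerBinom i (e i) j F) * δ ^ j =
      (s - ∑ j ∈ Finset.range N, δ ^ j • t j).hsum := by
    rw [SummableFamily.hsum_sub, h1]
    congr 1
    have h3 : ∀ w : SummableFamily Γ K (Fin n → L.exponents),
        w.hsum = (SummableFamily.lsum (Γ := Γ) (R := K) (α := Fin n → L.exponents)) w :=
      fun _ => rfl
    rw [h3, map_sum]
    refine Finset.sum_congr rfl fun j _ => ?_
    rw [h2, ← h3, SummableFamily.hsum_smul, mul_comm]
  rw [← sub_eq_zero, ← coeff_sub, hsum, SummableFamily.coeff_hsum]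
  refine finsum_eq_zero_of_forall_eq_zero fun γ => ?_
  rw [SummableFamily.sub_apply, SummableFamily.sum_apply, hs]
  set f := binomialPower (pw i) ((γ i : K) - e i) with hf
  set h : ℕ → PowerSeries K := fun j =>
    PowerSeries.C (genBinom ((γ i : K) - e i) j) * binomialPower (pw i) ((γ i : K) - e i - j)
  set rest := ∏ l ∈ Finset.univ.erase i,
    PowerSeries.heval (ε l) (binomialPower (pw l) ((γ l : K) - e l)) with hrest
  have hprod : powerProd pw ε e γ = rest * PowerSeries.heval (a + δ) f := by
    rw [powerProd, ← Finset.prod_erase_mul _ _ (Finset.mem_univ i), hi]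
  have hterm : ∀ j, (δ ^ j • t j) γ = single (weight v γ) (F.coeff γ) * rest *
      (PowerSeries.heval a (h j) * δ ^ j) := by
    intro j
    have h4 : powerProd pw (Function.update ε i a) (e + Pi.single i j) γ =
        rest * PowerSeries.heval a (binomialPower (pw i) ((γ i : K) - e i - j)) := by
      rw [powerProd, ← Finset.prod_erase_mul _ _ (Finset.mem_univ i), hrest]
      congr 1
      · refine Finset.prod_congr rfl fun l hl => ?_
        simp [Finset.ne_of_mem_erase hl]
      · simp [sub_sub]
    have h5 : PowerSeries.heval a (h j) = C (genBinom ((γ i : K) - e i) j) *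
        PowerSeries.heval a (binomialPower (pw i) ((γ i : K) - e i - j)) := by
      rw [map_mul, PowerSeries.heval_C, ← C_mul_eq_smul, mul_one]
    have h6 : single (weight v γ) ((eulerBinom i (e i) j F).coeff γ) =
        C (genBinom ((γ i : K) - e i) j) * single (weight v γ) (F.coeff γ) := by
      rw [C_mul_eq_smul]
      ext b
      by_cases hb : b = weight v γ
      · subst hb; simp [eulerBinom]
      · simp [coeff_single_of_ne hb]
    rw [SummableFamily.smul_apply, of_symm_smul_of_eq_mul, ht, h4, h5, h6]
    ring
  rw [Finset.sum_congr rfl fun j _ => hterm j, ← Finset.mul_sum, hprod, ← mul_assoc, ← mul_sub]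
  by_cases hγ : F.coeff γ = 0
  · simp [hγ]
  refine coeff_mul_eq_zero_of_lt (p := weight v γ) (q := N • p) (fun b hb => ?_) (fun b hb => ?_)
    (hg'.trans_le (hF γ hγ))
  · refine coeff_mul_eq_zero_of_lt (p := weight v γ) (q := 0)
      (fun c hc => coeff_single_of_ne hc.ne) (fun c hc => ?_) (by simpa using hb)
    by_contra hne
    have hnonneg : rest.support ⊆ AddSubmonoid.nonneg Γ :=
      support_prod_subset _ _ _ fun l _ => (support_heval_subset _ _).trans <|
        AddSubmonoid.closure_le.2 fun z hz =>
          WithTop.coe_le_coe.1 ((hε l).le.trans (orderTop_le_of_coeff_ne_zero hz))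
    exact absurd hc (not_lt.2 (hnonneg hne))
  · rw [coeff_sub, coeff_sum, sub_eq_zero]
    refine coeff_heval_add ha hδ hp hδp hb f h fun i' j => ?_
    rw [PowerSeries.coeff_C_mul, hf, choose_mul_coeff_binomialPower]

end EvalAt

end FunctionFamily

/-! ### Values of truncation-closed algebras of generalized power series -/

namespace FunctionFamily

open HahnSeries

variable {K : Type u} [Field K] [LinearOrder K] [IsStrictOrderedRing K] {L : FunctionFamily K}
  {n : ℕ}

/-- A `K`-algebra of generalized power series which is closed under truncations in each variable
and under renormalized derivatives. -/
structure IsTruncationAlgebra (A : Subring (L.Series n)) : Prop where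
  C_mem : ∀ c : K, C c ∈ A
  fragment_mem : ∀ F ∈ A, ∀ (i : Fin n) (b : L.exponents), F.fragment {γ | γ i < b} ∈ A
  euler_mem : ∀ F ∈ A, ∀ i : Fin n, Series.euler i F ∈ A

namespace IsTruncationAlgebra

variable {A : Subring (L.Series n)}

theorem fragment_compl_mem {F : L.Series n} (hF : F ∈ A) {S : Set (Fin n → L.exponents)}
    (h : F.fragment S ∈ A) : F.fragment Sᶜ ∈ A := by
  rw [← add_sub_cancel_left (F.fragment S) (F.fragment Sᶜ), fragment_add_fragment_compl]
  exact sub_mem hF h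

variable (hA : IsTruncationAlgebra A)
include hA

theorem eulerBinom_mem {F : L.Series n} (hF : F ∈ A) (i : Fin n) (e j : ℕ) :
    eulerBinom i e j F ∈ A := by
  induction j with
  | zero =>
    convert hF
    ext γ
    simp [eulerBinom]
  | succ j ih =>
    have h : eulerBinom i e (j + 1) F = C ((j : K) + 1)⁻¹ *
        (Series.euler i (eulerBinom i e j F) - C ((e : K) + j) * eulerBinom i e j F) := by
      ext γ
      rw [C_mul_eq_smul, C_mul_eq_smul, HahnSeries.coeff_smul, coeff_sub, HahnSeries.coeff_smul]
      simp only [eulerBinom, Series.euler, genBinom_succ, smul_eq_mul]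
      have : (j : K) + 1 ≠ 0 := Nat.cast_add_one_ne_zero j
      field_simp
      ring
    rw [h]
    exact mul_mem (hA.C_mem _) (sub_mem (hA.euler_mem _ ih i) (mul_mem (hA.C_mem _) ih))

theorem fragment_Ici_mem {F : L.Series n} (hF : F ∈ A) (μ : Fin n → L.exponents) :
    F.fragment (Set.Ici μ) ∈ A := by
  classical
  have : ∀ t : Finset (Fin n), F.fragment {γ | ∀ i ∈ t, μ i ≤ γ i} ∈ A := by
    intro t
    induction t using Finset.induction_on with
    | empty => rwa [fragment_eq_self (by simp)]
    | insert i t hi ih =>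
      have h := fragment_compl_mem ih (hA.fragment_mem _ ih i (μ i))
      rw [fragment_fragment] at h
      convert h using 2
      ext γ
      simp [and_comm]
  convert this Finset.univ using 2
  ext γ
  simp [Pi.le_def]

/-- As the support of a series is a well-partial order, its intersection with an upper set is
generated by finitely many elements. So the fragment given by an upper set is obtained by finitely
many truncations in single variables. -/
theorem fragment_upperSet_mem {F : L.Series n} (hF : F ∈ A) {U : Set (Fin n → L.exponents)}
    (hU : IsUpperSet U) : F.fragment U ∈ A := by
  classical
  have hpwo : (F.support ∩ U).IsPWO := F.isPWO_support.mono Set.inter_subset_left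
  have hfin : {μ | Minimal (· ∈ F.support ∩ U) μ}.Finite := by
    refine IsAntichain.finite_of_partiallyWellOrderedOn (r := (· ≤ ·)) ?_
      (hpwo.mono fun μ hμ => hμ.1)
    intro μ hμ ν hν hne hle
    exact hne (le_antisymm hle (hν.2 hμ.1 hle))
  have key : ∀ t : Finset (Fin n → L.exponents),
      F.fragment {γ | ∀ μ ∈ t, ¬ μ ≤ γ} ∈ A := by
    intro t
    induction t using Finset.induction_on with
    | empty => rwa [fragment_eq_self (by simp)]
    | insert μ t hi ih =>
      have h := fragment_compl_mem ih (hA.fragment_Ici_mem ih μ)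
      rw [fragment_fragment] at h
      convert h using 2
      ext γ
      simp [and_comm]
  have h := fragment_compl_mem hF (key hfin.toFinset)
  convert h using 1
  refine fragment_congr fun γ hγ => ?_
  simp only [Set.Finite.mem_toFinset, Set.mem_ofPred_eq, Set.mem_compl_iff, not_forall, not_not]
  constructor
  · intro hγU
    obtain ⟨μ, hle, hμ⟩ := hpwo.exists_le_minimal ⟨hγ, hγU⟩
    exact ⟨μ, hμ, hle⟩
  · rintro ⟨μ, hμ, hle⟩
    exact hU hle hμ.1.2

variable {Γ : Type v} [AddCommGroup Γ] [LinearOrder Γ] [IsOrderedAddMonoid Γ]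
  [Module L.exponents Γ] [IsStrictOrderedModule L.exponents Γ]
  {R : Subfield (HahnSeries Γ K)} {pw : Fin n → K → K} {k : Fin n → K} {v : Fin n → Γ}

/-- Suppose that the values in the series of a truncation-closed algebra, at points of the form
`t ^ vᵢ (kᵢ + εᵢ)` with `εᵢ ∈ coreRing R`, belong to `R`. Then all truncations of such values, also
after division by a product of powers of the `kᵢ + εᵢ`, belong to `R`.

This goes by recursion on the `εᵢ`. To truncate a value of `F` at `g`, split `F` in two: the
monomials `x ^ γ` for which all terms of the value have exponent `< g`, and the rest, which form an
upper set. For the latter there are a monomial `p` of some `εᵢ` and a number `N` such that the terms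
in the Taylor expansion of order `≥ N` in `εᵢ - εᵢ|p` have exponents `≥ g`. This leaves finitely
many terms, with derivatives of `F` evaluated at the point with `εᵢ|p` in place of `εᵢ`. -/
theorem evalAt_mem_coreRing (hk : ∀ i, k i ≠ 0) (hpw : ∀ i a, pw i (a + 1) = k i * pw i a)
    (hv : ∀ i, 0 < v i) (hC : ∀ c : K, (C c : HahnSeries Γ K) ∈ R)
    (hR : ∀ ε : Fin n → HahnSeries Γ K, (∀ i, 0 < (ε i).orderTop) → (∀ i, ε i ∈ coreRing R) →
      ∀ F ∈ A, evalAt pw v ε 0 F ∈ R) (ε : Fin n → HahnSeries Γ K) :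
    (∀ i, 0 < (ε i).orderTop) → (∀ i, ε i ∈ coreRing R) → ∀ F ∈ A, ∀ e,
      evalAt pw v ε e F ∈ coreRing R := by
  have hmem : ∀ ε : Fin n → HahnSeries Γ K, (∀ i, 0 < (ε i).orderTop) →
      (∀ i, ε i ∈ coreRing R) → ∀ F ∈ A, ∀ e, evalAt pw v ε e F ∈ R := by
    intro ε hε hεR F hF e
    have hne : ∏ i, (C (k i) + ε i) ^ e i ≠ 0 := by
      refine Finset.prod_ne_zero_iff.2 fun i _ => pow_ne_zero _ ?_
      refine ne_zero_of_coeff_ne_zero (g := 0) ?_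
      rw [coeff_add, C_apply, coeff_single_same, coeff_eq_zero_of_lt_orderTop (hε i), add_zero]
      exact hk i
    rw [eq_div_of_mul_eq hne (evalAt_mul_prod_pow hpw hv hε e F)]
    exact div_mem (hR ε hε hεR F hF)
      (prod_mem fun i _ => pow_mem (add_mem (hC _) (hεR i).1) _)
  induction ε using wellFounded_update_isProperTruncation.induction with
  | _ ε ih =>
  intro hε hεR F hF e
  refine ⟨hmem ε hε hεR F hF e, fun g => ?_⟩
  set U : Set (Fin n → L.exponents) := {γ | g ≤ weight v γ ∨
    ∃ i, ∃ p ∈ (ε i).support, ∃ N : ℕ, g ≤ weight v γ + N • p} with hU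
  have hUup : IsUpperSet U := by
    rintro γ γ' hle (h | ⟨i, p, hp, N, h⟩)
    · exact Or.inl (h.trans ((weight_strictMono hv).monotone hle))
    · exact Or.inr ⟨i, p, hp, N,
        h.trans (add_le_add_left ((weight_strictMono hv).monotone hle) _)⟩
  have hF3 := hA.fragment_upperSet_mem hF hUup
  have hF1 := fragment_compl_mem hF hF3
  rw [← fragment_add_fragment_compl F U, evalAt_add pw hv hε, truncation_add]
  refine add_mem ?_ ?_
  · set F3 := F.fragment U with hF3_def
    by_cases h0 : F3.support.Nonempty
    swap
    · rw [truncation_eq_zero]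
      · exact zero_mem R
      · intro a _
        by_contra hne
        obtain ⟨γ, hγ, -⟩ := exists_of_mem_support_evalAt hv hε hne
        exact h0 ⟨γ, hγ⟩
    obtain ⟨γ₀, hγ₀, hmin⟩ := Set.IsPWO.exists_minimalFor (weight v) F3.support
      (isPWO_weight_image hv F3) h0
    have hle : ∀ γ ∈ F3.support, weight v γ₀ ≤ weight v γ := fun γ hγ =>
      (le_total _ _).elim id fun h => hmin hγ h
    have hpos : ∀ i, ∀ p ∈ (ε i).support, 0 < p := fun i p hp =>
      WithTop.coe_lt_coe.1 ((hε i).trans_le (orderTop_le_of_coeff_ne_zero hp))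
    rcases ((F.mem_support_fragment).1 hγ₀).1 with hg | ⟨i, p, hp, N, hg⟩
    · rw [truncation_eq_zero]
      · exact zero_mem R
      · intro a ha
        by_contra hne
        obtain ⟨γ, hγ, s, hs, rfl⟩ := exists_of_mem_support_evalAt hv hε hne
        have hs0 : s ∈ AddSubmonoid.nonneg Γ := AddSubmonoid.closure_le.2 (fun z hz => by
          obtain ⟨i, hi⟩ := Set.mem_iUnion.1 hz
          exact (hpos i z hi).le) hs
        exact absurd ha (not_lt.2 ((hg.trans (hle γ hγ)).trans (le_add_of_nonneg_right hs0)))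
    -- Here `N` works for all monomials of the fragment, as `γ₀` has minimal weight.
    · set a := (ε i).truncation p with ha_def
      set δ := ε i - a with hδ_def
      have hap : 0 < a.orderTop := by
        refine lt_of_lt_of_le (hε i) (le_orderTop_iff_forall.2 fun b hb => ?_)
        by_contra hne
        exact absurd hb
          (not_lt.2 (orderTop_le_of_coeff_ne_zero ((mem_support_truncation _).1 hne).2))
      have hδ0 : ∀ b < p, δ.coeff b = 0 := fun b hb => coeff_sub_truncation_of_lt _ hb
      have hδp : 0 < δ.orderTop := by
        refine lt_of_lt_of_le (WithTop.coe_lt_coe.2 (hpos i p hp))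
          (le_orderTop_iff_forall.2 fun b hb => hδ0 b (WithTop.coe_lt_coe.1 hb))
      have haR : a ∈ coreRing R := truncation_mem_coreRing (hεR i) p
      have hεi : ε i = a + δ := by rw [hδ_def, add_sub_cancel]
      have hupd : ∀ P : HahnSeries Γ K → Prop, (∀ l, P (ε l)) → P a →
          ∀ l, P (Function.update ε i a l) := fun P h h' l => by
        by_cases hl : l = i
        · subst hl; simpa using h'
        · simpa [hl] using h l
      rw [truncation_congr fun b hb => coeff_evalAt_add hv hε hap hδp hεi (hpos i p hp) hδ0
        (fun γ hγ => hg.trans (add_le_add_left (hle γ hγ) _)) e hb]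
      refine (sum_mem (S := coreRing R) fun j _ => mul_mem (ih _ ⟨i, a, ⟨p, hp, rfl⟩, rfl⟩
        (hupd (0 < ·.orderTop) hε hap) (hupd (· ∈ coreRing R) hεR haR) _
        (hA.eulerBinom_mem hF3 i (e i) j) _)
        (pow_mem (sub_mem (hεR i) haR) j)).2 g
  · rw [truncation_eq_self]
    · exact hmem ε hε hεR _ hF1 e
    · intro a ha
      obtain ⟨γ, hγ, s, hs, rfl⟩ := exists_of_mem_support_evalAt hv hε ha
      have hγU := ((F.mem_support_fragment).1 hγ).1
      simp only [hU, Set.mem_compl_iff, Set.mem_ofPred_eq, not_or, not_exists, not_and, not_le]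
        at hγU
      -- an element of the monoid generated by the supports is at most a multiple of a generator
      have hs' : s = 0 ∨ ∃ i, ∃ p ∈ (ε i).support, ∃ N : ℕ, s ≤ N • p := by
        refine AddSubmonoid.closure_induction
          (motive := fun s _ => s = 0 ∨ ∃ i, ∃ p ∈ (ε i).support, ∃ N : ℕ, s ≤ N • p)
          (fun z hz => ?_) (Or.inl rfl) (fun x y _ _ hx hy => ?_) hs
        · obtain ⟨i, hi⟩ := Set.mem_iUnion.1 hz
          exact Or.inr ⟨i, z, hi, 1, (one_nsmul z).ge⟩
        · rcases hx with rfl | ⟨i, p, hp, N, hN⟩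
          · rwa [zero_add]
          rcases hy with rfl | ⟨i', p', hp', N', hN'⟩
          · rw [add_zero]
            exact Or.inr ⟨i, p, hp, N, hN⟩
          right
          rcases le_total p p' with h | h
          · exact ⟨i', p', hp', N + N', by
              rw [add_nsmul]; exact add_le_add (hN.trans (nsmul_le_nsmul_right h N)) hN'⟩
          · exact ⟨i, p, hp, N + N', by
              rw [add_nsmul]; exact add_le_add hN (hN'.trans (nsmul_le_nsmul_right h N'))⟩
      rcases hs' with rfl | ⟨i, p, hp, N, hN⟩
      · rw [add_zero]
        exact hγU.1
      · exact (add_le_add_right hN _).trans_lt (hγU.2 i p hp N)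

end IsTruncationAlgebra

end FunctionFamily

/-! ### Power functions are determined by their exponents -/

section Sup

variable {K : Type u} [Field K] [LinearOrder K] [IsStrictOrderedRing K]

/-- Definable sets in o-minimal structures have suprema. -/
theorem IsOMinimal.exists_isLUB {L : FirstOrder.Language} [L.Structure K] (h : IsOMinimal L K)
    {S : Set K} (hS : (Set.univ : Set K).Definable₁ L S) (hne : S.Nonempty) (hb : BddAbove S) :
    ∃ b, IsLUB S b := by
  obtain ⟨F, hF, rfl, hint⟩ := h S hS
  have key : ⋃₀ F = ∅ ∨ ∃ b, IsLUB (⋃₀ F) b := by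
    clear hne hS
    induction F, hF using Set.Finite.induction_on with
    | empty => simp
    | @insert I F _ _ ih =>
      rw [Set.sUnion_insert] at hb ⊢
      have hbI := hb.mono Set.subset_union_left
      have h1 : I = ∅ ∨ ∃ b, IsLUB I b := by
        rcases hint I (Set.mem_insert _ _) with ⟨a, rfl⟩ | ⟨a, b, rfl⟩ | ⟨a, rfl⟩ | ⟨a, rfl⟩ | rfl
        · exact Or.inr ⟨a, isLUB_singleton⟩
        · rcases lt_or_ge a b with hab | hab
          · exact Or.inr ⟨b, isLUB_Ioo hab⟩
          · exact Or.inl (Set.Ioo_eq_empty (not_lt.2 hab))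
        · exact Or.inr ⟨a, isLUB_Iio⟩
        · exact absurd hbI (not_bddAbove_Ioi a)
        · exact absurd hbI not_bddAbove_univ
      have h2 := ih (fun J hJ => hint J (Set.mem_insert_of_mem _ hJ))
        (hb.mono Set.subset_union_right)
      rcases h1 with h1 | ⟨b, hb1⟩
      · rw [h1, Set.empty_union]
        exact h2
      · rcases h2 with h2 | ⟨c, hc⟩
        · rw [h2, Set.union_empty]
          exact Or.inr ⟨b, hb1⟩
        · exact Or.inr ⟨_, hb1.union hc⟩
  exact key.resolve_left hne.ne_empty

/-- A multiplicative function with vanishing derivative at `1` grows at most linearly with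
arbitrarily small slope: it suffices to see that the supremum of an interval on which this holds
cannot be finite. -/
theorem le_one_add_mul_of_multiplicative {r : K → K} (hpos : ∀ x, 0 < x → 0 < r x)
    (hmul : ∀ x y, 0 < x → 0 < y → r (x * y) = r x * r y)
    (hder : ∀ ε > 0, ∃ δ > 0, ∀ h, 0 < h → h < δ → r (1 + h) ≤ 1 + ε * h)
    (hsup : ∀ ε : K, BddAbove {y | ∀ t, 1 < t → t ≤ y → r t ≤ 1 + ε * (t - 1)} →
      ∃ b, IsLUB {y | ∀ t, 1 < t → t ≤ y → r t ≤ 1 + ε * (t - 1)} b)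
    {ε : K} (hε : 0 < ε) (hε1 : ε ≤ 1) {y : K} (hy : 1 < y) : r y ≤ 1 + ε * (y - 1) := by
  set S := {y : K | ∀ t, 1 < t → t ≤ y → r t ≤ 1 + ε * (t - 1)} with hS
  suffices y ∈ S from this y hy le_rfl
  by_contra hyS
  have hdown : ∀ s ∈ S, ∀ s' ≤ s, s' ∈ S := fun s hs s' hle t h1 h2 => hs t h1 (h2.trans hle)
  have hbdd : ∀ s ∈ S, s ≤ y := fun s hs => not_lt.1 fun hlt => hyS (hdown s hs y hlt.le)
  obtain ⟨b, hb⟩ := hsup ε ⟨y, hbdd⟩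
  have h1S : (1 : K) ∈ S := fun t h1 h2 => absurd h1 (not_lt.2 h2)
  have hb1 : 1 ≤ b := hb.1 h1S
  have hb0 : 0 < b := one_pos.trans_le hb1
  have hltS : ∀ t < b, t ∈ S := fun t ht => by
    obtain ⟨s, hs, hts⟩ := (lt_isLUB_iff hb).1 ht
    exact hdown s hs t hts.le
  obtain ⟨δ, hδ, hder⟩ := hder ε hε
  have hr1 : r 1 = 1 := by
    have h := hmul 1 1 one_pos one_pos
    rw [mul_one] at h
    exact (mul_right_cancel₀ (hpos 1 one_pos).ne' (h.symm.trans (one_mul _).symm))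
  have step : ∀ s t, 1 ≤ s → s < t → t - s < δ * s → r s ≤ 1 + ε * (s - 1) →
      r t ≤ 1 + ε * (t - 1) := by
    intro s t hs hst hδs hrs
    have hs0 : 0 < s := one_pos.trans_le hs
    have hh : 0 < (t - s) / s := div_pos (sub_pos.2 hst) hs0
    have h1 := hder _ hh ((div_lt_iff₀ hs0).2 hδs)
    have ht : t = s * (1 + (t - s) / s) := by field_simp; ring
    have h2 : 1 + ε * (s - 1) ≤ s := by nlinarith
    have h3 : s * ((t - s) / s) = t - s := by field_simp
    rw [ht, hmul _ _ hs0 (by positivity), ← ht]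
    calc r s * r (1 + (t - s) / s) ≤ (1 + ε * (s - 1)) * (1 + ε * ((t - s) / s)) := by
          apply mul_le_mul hrs h1 (hpos _ (by positivity)).le
          nlinarith
      _ = 1 + ε * (s - 1) + (1 + ε * (s - 1)) * (ε * ((t - s) / s)) := by ring
      _ ≤ 1 + ε * (s - 1) + s * (ε * ((t - s) / s)) := by gcongr
      _ = 1 + ε * (s - 1) + ε * (s * ((t - s) / s)) := by ring
      _ = 1 + ε * (t - 1) := by rw [h3]; ring
  have hrb : r b ≤ 1 + ε * (b - 1) := by
    rcases hb1.eq_or_lt with rfl | hb1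
    · simp [hr1]
    · obtain ⟨s, hs, hsb⟩ := exists_between (max_lt hb1 (sub_lt_self b hδ))
      obtain ⟨hs1, hs2⟩ := max_lt_iff.1 hs
      exact step s b hs1.le hsb (by nlinarith) (hltS s hsb s hs1 le_rfl)
  have hb' : b + δ / 2 ∈ S := by
    intro t h1 h2
    rcases lt_trichotomy t b with h | rfl | h
    · exact hltS t h t h1 le_rfl
    · exact hrb
    · exact step b t hb1 h (by nlinarith) hrb
  exact absurd (hb.1 hb') (not_le.2 (lt_add_of_pos_right b (half_pos hδ)))

end Sup

namespace FunctionFamily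

section Definability

variable {K : Type u} [Field K] [LinearOrder K] {L : FunctionFamily K}

theorem definable_lt {α : Type*} {f g : (α → K) → K}
    (hf : (Set.univ : Set K).DefinableFun L.language f)
    (hg : (Set.univ : Set K).DefinableFun L.language g) :
    (Set.univ : Set K).Definable L.language {w | f w < g w} := by
  have h : (Set.univ : Set K).Definable L.language {w : Fin 2 → K | w 0 < w 1} := by
    refine Set.Definable.mono (Set.empty_definable_iff.2
      ⟨(show L.language.Relations 2 from Rel.lt).formula₂ (Language.Term.var 0)
        (Language.Term.var 1), ?_⟩) (Set.empty_subset _)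
    ext w
    rfl
  have hF : (Set.univ : Set K).DefinableMap L.language fun w => ![f w, g w] := by
    intro i
    fin_cases i
    · exact hf
    · exact hg
  exact h.preimage_map hF

theorem definableFun_mul {α : Type*} {f g : (α → K) → K}
    (hf : (Set.univ : Set K).DefinableFun L.language f)
    (hg : (Set.univ : Set K).DefinableFun L.language g) :
    (Set.univ : Set K).DefinableFun L.language fun w => f w * g w := by
  have hF : (Set.univ : Set K).DefinableMap L.language fun w => ![f w, g w] := by
    intro i
    fin_cases i
    · exact hf
    · exact hg
  exact ((Set.DefinableFun.fun_symbol (L := L.language) (M := K) Func.mul).of_empty).comp hF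

theorem definableFun_add {α : Type*} {f g : (α → K) → K}
    (hf : (Set.univ : Set K).DefinableFun L.language f)
    (hg : (Set.univ : Set K).DefinableFun L.language g) :
    (Set.univ : Set K).DefinableFun L.language fun w => f w + g w := by
  have hF : (Set.univ : Set K).DefinableMap L.language fun w => ![f w, g w] := by
    intro i
    fin_cases i
    · exact hf
    · exact hg
  exact ((Set.DefinableFun.fun_symbol (L := L.language) (M := K) Func.add).of_empty).comp hF

theorem definableFun_inv {α : Type*} {f : (α → K) → K}
    (hf : (Set.univ : Set K).DefinableFun L.language f) :
    (Set.univ : Set K).DefinableFun L.language fun w => (f w)⁻¹ := by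
  have hF : (Set.univ : Set K).DefinableMap L.language fun w => ![f w] := by
    intro i
    fin_cases i
    exact hf
  exact ((Set.DefinableFun.fun_symbol (L := L.language) (M := K) Func.inv).of_empty).comp hF

theorem definableFun_comp_apply {α : Type*} {f : K → K}
    (hf : (Set.univ : Set K).DefinableFun L.language fun v : Fin 1 → K => f (v 0)) (i : α) :
    (Set.univ : Set K).DefinableFun L.language fun w : α → K => f (w i) := by
  have hF : (Set.univ : Set K).DefinableMap L.language fun (w : α → K) (_ : Fin 1) => w i :=
    fun _ => Set.DefinableFun.proj L.language
  exact hf.comp hF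

theorem definable_slope_bound {r : K → K}
    (hr : (Set.univ : Set K).DefinableFun L.language fun v : Fin 1 → K => r (v 0)) (ε : K) :
    (Set.univ : Set K).Definable₁ L.language
      {y | ∀ t, 1 < t → t ≤ y → r t ≤ 1 + ε * (t - 1)} := by
  have hc : ∀ c : K, (Set.univ : Set K).DefinableFun L.language
      fun _ : Fin 1 ⊕ Fin 1 → K => c := fun c =>
    L.language.definableFun_const _ (Set.mem_univ c)
  have hp : ∀ i, (Set.univ : Set K).DefinableFun L.language
      fun w : Fin 1 ⊕ Fin 1 → K => w i := fun i => Set.DefinableFun.proj L.language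
  have h1 := definable_lt (hc 1) (hp (Sum.inr 0))
  have h2 := definable_lt (hp (Sum.inl 0)) (hp (Sum.inr 0))
  have h3 := definable_lt (definableFun_add (hc 1) (definableFun_mul (hc ε)
    (definableFun_add (hp (Sum.inr 0)) (hc (-1))))) (definableFun_comp_apply hr (Sum.inr 0))
  have h := ((h1.compl.union h2).union h3.compl).forall_of_finite
  rw [Set.Definable₁]
  convert h using 1
  ext v
  simp only [Set.mem_ofPred_eq, Set.mem_union, Set.mem_compl_iff, Sum.elim_inl, Sum.elim_inr,
    not_lt, ← sub_eq_add_neg]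
  constructor
  · intro H u
    rcases le_or_gt (u 0) 1 with h1 | h1
    · exact Or.inl (Or.inl h1)
    rcases lt_or_ge (v 0) (u 0) with h2 | h2
    · exact Or.inl (Or.inr h2)
    exact Or.inr (H _ h1 h2)
  · intro H t h1 h2
    rcases H fun _ => t with (h | h) | h
    · exact absurd h1 (not_lt.2 h)
    · exact absurd h2 (not_le.2 h)
    · exact h

end Definability

variable {K : Type u} [Field K] [LinearOrder K] [IsStrictOrderedRing K] {L : FunctionFamily K}

variable {p q : {x : K // 0 < x} →* {x : K // 0 < x}}

theorem extendPos_of_pos {x : K} (hx : 0 < x) : extendPos p x = p ⟨x, hx⟩ :=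
  dif_pos hx

theorem extendPos_pos {x : K} (hx : 0 < x) : 0 < extendPos p x := by
  rw [extendPos_of_pos hx]
  exact (p _).2

theorem extendPos_mul {x y : K} (hx : 0 < x) (hy : 0 < y) :
    extendPos p (x * y) = extendPos p x * extendPos p y := by
  rw [extendPos_of_pos hx, extendPos_of_pos hy, extendPos_of_pos (mul_pos hx hy)]
  exact congrArg Subtype.val (p.map_mul ⟨x, hx⟩ ⟨y, hy⟩)

theorem extendPos_one : extendPos p 1 = 1 := by
  rw [extendPos_of_pos one_pos]
  exact congrArg Subtype.val p.map_one

/-- The quotient `r` of two power functions with the same exponent has derivative `0` at `1`, so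
that `r y ≤ 1 + ε (y - 1)` for all `ε > 0`. -/
theorem IsPowerWithExponent.extendPos_le (hmin : IsOMinimal L.language K) {a : K}
    (hp : L.IsPowerWithExponent p a) (hq : L.IsPowerWithExponent q a) {y : K} (hy : 1 < y) :
    extendPos p y ≤ extendPos q y := by
  have hy0 : 0 < y := one_pos.trans hy
  set r : K → K := fun x => extendPos p x * (extendPos q x)⁻¹ with hr
  have hdef : (Set.univ : Set K).DefinableFun L.language fun v : Fin 1 → K => r (v 0) :=
    definableFun_mul hp.1 (definableFun_inv hq.1)
  have key : ∀ ε : K, 0 < ε → ε ≤ 1 → r y ≤ 1 + ε * (y - 1) := fun ε hε hε1 => by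
    refine le_one_add_mul_of_multiplicative
      (fun x hx => show 0 < extendPos p x * (extendPos q x)⁻¹ from
        mul_pos (extendPos_pos hx) (inv_pos.2 (extendPos_pos hx)))
      (fun x y hx hy => ?_) (fun ε hε => ?_) (fun ε hb => ?_) hε hε1 hy
    · simp only [extendPos_mul hx hy, mul_inv]
      ring
    · obtain ⟨δ₁, hδ₁, h1⟩ := hp.2 (ε / 4) (by positivity)
      obtain ⟨δ₂, hδ₂, h2⟩ := hq.2 (ε / 4) (by positivity)
      obtain ⟨δ₃, hδ₃, h3⟩ := hq.2 1 one_pos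
      -- the last bound makes `q (1 + h)` at least `1 / 2`
      refine ⟨min (min δ₁ δ₂) (min δ₃ (1 / (2 * (|a| + 1)))), by positivity, fun h hh hlt => ?_⟩
      simp only [lt_min_iff] at hlt
      obtain ⟨⟨l1, l2⟩, l3, l4⟩ := hlt
      rw [lt_div_iff₀ (by positivity)] at l4
      have e1 := h1 h (by rwa [abs_of_pos hh])
      have e2 := h2 h (by rwa [abs_of_pos hh])
      have e3 := h3 h (by rwa [abs_of_pos hh])
      rw [extendPos_one, abs_of_pos hh, abs_le] at e1 e2 e3
      have ha := neg_abs_le a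
      have hq2 : 1 / 2 ≤ extendPos q (1 + h) := by nlinarith
      have hq0 : 0 < extendPos q (1 + h) := by linarith
      rw [mul_inv_le_iff₀ hq0]
      nlinarith [mul_le_mul_of_nonneg_left hq2 (mul_pos hε hh).le]
    · exact hmin.exists_isLUB (definable_slope_bound hdef ε)
        ⟨1, fun t h1 h2 => absurd h1 (not_lt.2 h2)⟩ hb
  have hle : r y ≤ 1 := by
    by_contra h
    rw [not_le] at h
    have hy1 : 0 < y - 1 := sub_pos.2 hy
    set d := (r y - 1) / (2 * (y - 1)) with hd
    have hd0 : 0 < d := div_pos (sub_pos.2 h) (by positivity)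
    have h1 := key (min d 1) (lt_min hd0 one_pos) (min_le_right _ _)
    have h2 : min d 1 * (y - 1) ≤ d * (y - 1) := by
      gcongr
      exact min_le_left _ _
    have h3 : d * (y - 1) = (r y - 1) / 2 := by rw [hd]; field_simp
    linarith
  simp only [hr] at hle
  rwa [mul_inv_le_iff₀ (extendPos_pos hy0), one_mul] at hle

theorem IsPowerWithExponent.extendPos_eq (hmin : IsOMinimal L.language K) {a : K}
    (hp : L.IsPowerWithExponent p a) (hq : L.IsPowerWithExponent q a) {y : K} (hy : 0 < y) :
    extendPos p y = extendPos q y := by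
  have h1 : ∀ y, 1 < y → extendPos p y = extendPos q y := fun y hy =>
    le_antisymm (hp.extendPos_le hmin hq hy) (hq.extendPos_le hmin hp hy)
  rcases lt_trichotomy y 1 with h | rfl | h
  · have hi : 0 < y⁻¹ := inv_pos.2 hy
    have h2 := extendPos_mul (p := p) hy hi
    have h3 := extendPos_mul (p := q) hy hi
    rw [mul_inv_cancel₀ hy.ne', extendPos_one] at h2 h3
    rw [h1 _ ((one_lt_inv₀ hy).2 h)] at h2
    exact mul_right_cancel₀ (extendPos_pos hi).ne' (h2.symm.trans h3)
  · rw [extendPos_one, extendPos_one]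
  · exact h1 y h

theorem power_eq (hmin : IsOMinimal L.language K) {a : K} (hp : L.IsPowerWithExponent p a) {y : K}
    (hy : 0 < y) : L.power a y = extendPos p y := by
  have h : ∃ p, L.IsPowerWithExponent p a := ⟨p, hp⟩
  rw [power, dif_pos h]
  exact h.choose_spec.extendPos_eq hmin hp hy

theorem power_zero (hmin : IsOMinimal L.language K) {y : K} (hy : 0 < y) : L.power 0 y = 1 := by
  have h : L.IsPowerWithExponent 1 0 := by
    have h1 : ∀ x : K, 0 < x → extendPos 1 x = 1 := fun x hx => extendPos_of_pos hx
    constructor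
    · have hc := fun c : K => L.language.definableFun_const (Fin 1) (Set.mem_univ c)
      have := Set.DefinableFun.ite (p := fun v : Fin 1 → K => 0 < v 0)
        (definable_lt (L := L) (hc 0) (Set.DefinableFun.proj L.language)) (hc 1) (hc 0)
      rw [IsPowerFunction]
      convert this using 1
      ext v
      by_cases hv : 0 < v 0
      · simp [h1 _ hv, hv]
      · simp [extendPos, hv]
    · intro ε hε
      refine ⟨1, one_pos, fun h hh => ?_⟩
      have : 0 < 1 + h := by linarith [(abs_lt.1 hh).1]
      rw [h1 _ this, h1 _ one_pos]
      simpa using mul_nonneg hε.le (abs_nonneg h)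
  rw [power_eq hmin h hy]
  exact extendPos_of_pos hy

theorem IsPowerWithExponent.mul_id {a : K} (hp : L.IsPowerWithExponent p a) :
    L.IsPowerWithExponent (p * MonoidHom.id _) (a + 1) := by
  have h1 : ∀ x : K, extendPos (p * MonoidHom.id _) x = extendPos p x * x := fun x => by
    by_cases hx : 0 < x <;> simp [extendPos, hx]
  refine ⟨?_, fun ε hε => ?_⟩
  · simp only [IsPowerFunction, h1]
    exact definableFun_mul hp.1 (Set.DefinableFun.proj L.language)
  · obtain ⟨δ, hδ, H⟩ := hp.2 (ε / 4) (by positivity)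
    refine ⟨min δ (min 1 (ε / (2 * (|a| + 1)))), by positivity, fun h hh => ?_⟩
    simp only [lt_min_iff] at hh
    obtain ⟨l1, l2, l3⟩ := hh
    have e := H h l1
    rw [lt_div_iff₀ (by positivity)] at l3
    rw [h1, h1, extendPos_one]
    rw [extendPos_one] at e
    set α := extendPos p (1 + h) - 1 - a * h with hα
    have : extendPos p (1 + h) * (1 + h) - 1 * 1 - (a + 1) * h = α * (1 + h) + a * h * h := by
      rw [hα]; ring
    rw [this]
    have h2 : |1 + h| ≤ 2 := (abs_add_le _ _).trans (by rw [abs_one]; linarith)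
    calc |α * (1 + h) + a * h * h| ≤ |α * (1 + h)| + |a * h * h| := abs_add_le _ _
      _ = |α| * |1 + h| + |a| * |h| * |h| := by rw [abs_mul, abs_mul, abs_mul]
      _ ≤ (ε / 4 * |h|) * 2 + |a| * |h| * |h| := by gcongr
      _ ≤ ε * |h| := by nlinarith [abs_nonneg h, abs_nonneg a]

theorem IsPowerWithExponent.div_id {a : K} (hp : L.IsPowerWithExponent p (a + 1)) :
    L.IsPowerWithExponent (p * (MonoidHom.id _)⁻¹) a := by
  have h1 : ∀ x : K, extendPos (p * (MonoidHom.id _)⁻¹) x = extendPos p x * x⁻¹ := fun x => by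
    by_cases hx : 0 < x <;> simp [extendPos, hx]
  refine ⟨?_, fun ε hε => ?_⟩
  · simp only [IsPowerFunction, h1]
    exact definableFun_mul hp.1 (definableFun_inv (Set.DefinableFun.proj L.language))
  · obtain ⟨δ, hδ, H⟩ := hp.2 (ε / 4) (by positivity)
    refine ⟨min δ (min (1 / 2) (ε / (4 * (|a| + 1)))), by positivity, fun h hh => ?_⟩
    simp only [lt_min_iff] at hh
    obtain ⟨l1, l2, l3⟩ := hh
    have e := H h l1
    rw [lt_div_iff₀ (by positivity)] at l3
    rw [h1, h1, extendPos_one]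
    rw [extendPos_one] at e
    have hh0 : 1 / 2 ≤ 1 + h := by linarith [(abs_lt.1 l2).1]
    have hh1 : 0 < 1 + h := by linarith
    set α := extendPos p (1 + h) - 1 - (a + 1) * h with hα
    have : extendPos p (1 + h) * (1 + h)⁻¹ - 1 * 1⁻¹ - a * h = (α - a * h * h) / (1 + h) := by
      rw [hα]; field_simp; ring
    rw [this, abs_div, abs_of_pos hh1, div_le_iff₀ hh1]
    calc |α - a * h * h| ≤ |α| + |a * h * h| := abs_sub _ _
      _ = |α| + |a| * |h| * |h| := by rw [abs_mul, abs_mul]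
      _ ≤ ε / 4 * |h| + |a| * |h| * |h| := by gcongr
      _ ≤ ε * |h| * (1 / 2) := by nlinarith [abs_nonneg h, abs_nonneg a]
      _ ≤ ε * |h| * (1 + h) := by gcongr

/-- This holds for all `a`: if `a` is not an exponent, then neither is `a + 1`, and both sides are
`0`. -/
theorem power_add_one (hmin : IsOMinimal L.language K) (a : K) {y : K} (hy : 0 < y) :
    L.power (a + 1) y = y * L.power a y := by
  by_cases h : ∃ p, L.IsPowerWithExponent p a
  · obtain ⟨p, hp⟩ := h
    rw [power_eq hmin hp hy, power_eq hmin hp.mul_id hy, extendPos_of_pos hy, extendPos_of_pos hy,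
      mul_comm]
    rfl
  · have h' : ¬ ∃ p, L.IsPowerWithExponent p (a + 1) := fun ⟨p, hp⟩ => h ⟨_, hp.div_id⟩
    rw [power, power, dif_neg h, dif_neg h', mul_zero]

end FunctionFamily

/-! ### Definable closure and generated substructures -/

section ModelTheory

open Language

/-- The sentence saying that `φ(x, t(x))` holds for some `t ∈ s` whenever `∃ y, φ(x, y)`. -/
def skolemSentence {L : FirstOrder.Language} {n : ℕ} (φ : L.Formula (Fin n ⊕ Unit))
    (s : Finset (L.Term (Fin n))) : L.Sentence :=
  Formula.iAlls (Fin n) (Formula.relabel (Sum.inr : Fin n → Empty ⊕ Fin n) ((φ.iExs Unit).imp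
    (Formula.iSup fun t : s => BoundedFormula.subst φ (Sum.elim Term.var fun _ => t.1))))

theorem realize_skolemSentence {L : FirstOrder.Language} {n : ℕ} (φ : L.Formula (Fin n ⊕ Unit))
    (s : Finset (L.Term (Fin n))) (M : Type*) [L.Structure M] :
    M ⊨ skolemSentence φ s ↔ ∀ x : Fin n → M,
      (∃ y : M, φ.Realize (Sum.elim x fun _ => y)) →
        ∃ t ∈ s, φ.Realize (Sum.elim x fun _ => t.realize x) := by
  simp only [Sentence.Realize, skolemSentence, Formula.realize_iAlls, Formula.realize_relabel,
    Formula.realize_imp, Formula.realize_iExs, Formula.realize_iSup, Subtype.exists]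
  refine forall_congr' fun x => imp_congr ⟨?_, ?_⟩ ?_
  · rintro ⟨u, hu⟩
    exact ⟨u (), hu⟩
  · rintro ⟨y, hy⟩
    exact ⟨fun _ => y, hy⟩
  · refine exists_congr fun t => ?_
    rw [exists_prop]
    refine and_congr_right fun _ => ?_
    rw [Formula.Realize, BoundedFormula.realize_subst, Formula.Realize]
    refine iff_of_eq (congrArg₂ _ ?_ rfl)
    funext a
    rcases a with a | a <;> rfl

/-- The Skolem terms of a structure are also Skolem terms in all elementarily equivalent structures,
of whatever size. -/
theorem IsPiecewiseSkolem.exists_terms {L : FirstOrder.Language.{u, 0}} {M : Type u}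
    [L.Structure M] [Nonempty M] (h : IsPiecewiseSkolem (L.completeTheory M)) {N : Type*}
    [L.Structure N] (hMN : M ≅[L] N) {n : ℕ} (φ : L.Formula (Fin n ⊕ Unit)) :
    ∃ s : Finset (L.Term (Fin n)), ∀ (x : Fin n → N) (y : N),
      φ.Realize (Sum.elim x fun _ => y) → ∃ t ∈ s, φ.Realize (Sum.elim x fun _ => t.realize x) := by
  obtain ⟨s, hs⟩ := h n φ
  have hM : M ⊨ skolemSentence φ s :=
    (realize_skolemSentence φ s M).2 fun x => hs (Theory.ModelType.of _ M) x
  exact ⟨s, fun x y hy =>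
    (realize_skolemSentence φ s N).1 ((hMN.realize_sentence _).1 hM) x ⟨y, hy⟩⟩

theorem closure_subset_definableClosure {L : FirstOrder.Language} {M : Type*} [L.Structure M]
    (A : Set M) : (Substructure.closure L A : Set M) ⊆ definableClosure L A := by
  intro y hy
  obtain ⟨t, rfl⟩ := Substructure.mem_closure_iff_exists_term.1 hy
  refine Set.definable_iff_exists_formula_sum.2
    ⟨(Term.var (Sum.inr 0)).equal (t.relabel Sum.inl), ?_⟩
  ext v
  simp [Formula.realize_equal, Term.realize_relabel, Function.comp_def]

theorem definableClosure_subset_closure {L : FirstOrder.Language.{u, 0}} {M : Type u}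
    [L.Structure M] [Nonempty M] (h : IsPiecewiseSkolem (L.completeTheory M)) {N : Type*}
    [L.Structure N] (hMN : M ≅[L] N) (A : Set N) :
    definableClosure L A ⊆ Substructure.closure L A := by
  intro y hy
  obtain ⟨A₀, hA₀, hd⟩ := Set.definable_iff_finitely_definable.1 hy
  obtain ⟨φ, hφ⟩ := Set.definable_iff_exists_formula_sum.1 hd
  let e : (A₀ : Set N) ≃ Fin A₀.card := A₀.equivFin
  let φ' : L.Formula (Fin A₀.card ⊕ Unit) := φ.relabel (Sum.map e fun _ => ())
  let x : Fin A₀.card → N := fun i => e.symm i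
  have key : ∀ z, φ'.Realize (Sum.elim x fun _ => z) ↔ z = y := by
    intro z
    have : (fun _ : Fin 1 => z) ∈ {v : Fin 1 → N | v 0 ∈ ({y} : Set N)} ↔ z = y := Iff.rfl
    rw [← this, hφ, Formula.realize_relabel, Set.mem_ofPred_eq]
    refine iff_of_eq (congrArg _ ?_)
    funext a
    rcases a with a | a
    · simp [x]
    · rfl
  obtain ⟨s, hs⟩ := h.exists_terms hMN φ'
  obtain ⟨t, -, ht⟩ := hs x y ((key y).2 rfl)
  rw [key] at ht
  rw [← ht]
  exact Term.realize_mem t x fun i => Substructure.subset_closure (hA₀ (e.symm i).2)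

end ModelTheory

/-! ### The evaluation of series at tuples of positive infinitesimals -/

namespace FunctionFamily

open HahnSeries

section Tail

variable {K : Type u} [Field K] {Γ : Type v} [AddCommGroup Γ] [LinearOrder Γ]
  [IsOrderedAddMonoid Γ]

theorem orderTop_pos_of_coeff_eq_zero {y : HahnSeries Γ K} (h : ∀ b ≤ 0, y.coeff b = 0) :
    0 < y.orderTop := by
  by_contra hn
  rw [not_lt] at hn
  have hy : y ≠ 0 := by
    rintro rfl
    simp at hn
  rw [← order_eq_orderTop_of_ne_zero hy] at hn
  exact hy (coeff_order_eq_zero.1 (h _ (WithTop.coe_le_coe.1 hn)))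

theorem orderTop_tail_pos (y : HahnSeries Γ K) : 0 < (tail y).orderTop := by
  refine orderTop_pos_of_coeff_eq_zero fun b hb => ?_
  rw [tail, coeff_sub, coeff_single_mul, one_mul, sub_neg_eq_add, C_apply]
  rcases hb.lt_or_eq with hb | rfl
  · rw [coeff_single_of_ne hb.ne, coeff_eq_zero_of_lt_order (by simpa using hb), sub_zero]
  · rw [coeff_single_same, zero_add, leadingCoeff_eq, sub_self]

theorem single_order_mul_tail (y : HahnSeries Γ K) :
    single y.order 1 * (C y.leadingCoeff + tail y) = y := by
  rw [tail, add_sub_cancel, ← mul_assoc, single_mul_single, add_neg_cancel, one_mul,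
    single_zero_one, one_mul]

theorem prod_smul_eq_C_mul {n : ℕ} (c : Fin n → K) (z : Fin n → HahnSeries Γ K) :
    ∏ i, c i • z i = C (∏ i, c i) * ∏ i, z i := by
  rw [Finset.prod_smul, C_mul_eq_smul]

theorem C_mul_C_mul_single (a b : K) (g : Γ) (z : HahnSeries Γ K) :
    C a * C b * single g 1 * z = single g a * (C b * z) := by
  have : single g a = C a * single g (1 : K) := by
    rw [C_apply, single_mul_single, zero_add, mul_one]
  rw [this]
  ring

variable {a v : Γ} {k : K} {ε : HahnSeries Γ K}

theorem order_C_add (hk : k ≠ 0) (hε : 0 < ε.orderTop) :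
    (C k + ε).order = 0 ∧ (C k + ε).leadingCoeff = k := by
  have h0 : (C k + ε).coeff 0 = k := by
    rw [coeff_add, C_apply, coeff_single_same, coeff_eq_zero_of_lt_orderTop hε, add_zero]
  have hne : C k + ε ≠ 0 := ne_zero_of_coeff_ne_zero (g := 0) (by rwa [h0])
  have h1 : (C k + ε).order = 0 := by
    refine le_antisymm (order_le_of_coeff_ne_zero (by rwa [h0])) (not_lt.1 fun hlt => ?_)
    refine hne (coeff_order_eq_zero.1 ?_)
    have h2 : ∀ b < 0, (C k + ε).coeff b = 0 := fun b hb => by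
      rw [coeff_add, C_apply, coeff_single_of_ne hb.ne,
        coeff_eq_zero_of_lt_orderTop ((WithTop.coe_lt_coe.2 hb).trans hε), add_zero]
    exact h2 _ hlt
  exact ⟨h1, by rw [leadingCoeff_eq, h1, h0]⟩

theorem order_single_mul_C_add (hk : k ≠ 0) (hε : 0 < ε.orderTop) :
    (single v 1 * (C k + ε)).order = v ∧ (single v 1 * (C k + ε)).leadingCoeff = k ∧
      tail (single v 1 * (C k + ε)) = ε := by
  obtain ⟨h1, h2⟩ := order_C_add hk hε
  have hne : C k + ε ≠ 0 := fun h => hk (by rw [← h2, h, leadingCoeff_zero])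
  have h3 : (single v 1 * (C k + ε)).order = v := by
    rw [order_mul (single_ne_zero one_ne_zero) hne, order_single one_ne_zero, h1, add_zero]
  have h4 : (single v 1 * (C k + ε)).leadingCoeff = k := by
    rw [leadingCoeff_mul, leadingCoeff_of_single, h2, one_mul]
  refine ⟨h3, h4, ?_⟩
  rw [tail, h3, h4, ← mul_assoc, single_mul_single, neg_add_cancel, one_mul, single_zero_one,
    one_mul, add_sub_cancel_left]

variable {R : Subfield (HahnSeries Γ K)} {y : HahnSeries Γ K}

theorem single_order_mem (hC : ∀ c : K, (C c : HahnSeries Γ K) ∈ R) (hy : y ∈ coreRing R)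
    (hy0 : y ≠ 0) : single y.order 1 ∈ R := by
  have h := mul_mem (leadingTerm_mem hy) (hC y.leadingCoeff⁻¹)
  rwa [C_apply, single_mul_single, add_zero, mul_inv_cancel₀ (leadingCoeff_ne_zero.2 hy0)] at h

theorem single_neg_mem (h : (single a 1 : HahnSeries Γ K) ∈ R) :
    (single (-a) 1 : HahnSeries Γ K) ∈ R := by
  have := inv_mem h
  rwa [inv_single, inv_one] at this

theorem C_mem_coreRing (hC : ∀ c : K, (C c : HahnSeries Γ K) ∈ R) (c : K) : C c ∈ coreRing R :=
  single_mem_truncationCore R (hC c)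

theorem tail_mem_coreRing (hC : ∀ c : K, (C c : HahnSeries Γ K) ∈ R) (hy : y ∈ coreRing R)
    (hy0 : y ≠ 0) : tail y ∈ coreRing R :=
  sub_mem (mul_mem (single_mem_truncationCore R (single_neg_mem (single_order_mem hC hy hy0))) hy)
    (C_mem_coreRing hC _)

/-- The leading monomial of `y - y₀`, where `y₀` is the constant term of `y`, is not `1`. So it or
its inverse is infinitesimal. -/
theorem exists_single_mem (hC : ∀ c : K, (C c : HahnSeries Γ K) ∈ R) (hy : y ∈ coreRing R)
    (hyc : ∀ c, y ≠ C c) : ∃ w : Γ, 0 < w ∧ (single w 1 : HahnSeries Γ K) ∈ R := by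
  have hz : y - C (y.coeff 0) ∈ coreRing R := sub_mem hy (C_mem_coreRing hC _)
  have hz0 : y - C (y.coeff 0) ≠ 0 := sub_ne_zero.2 (hyc _)
  have hmem := single_order_mem hC hz hz0
  have hz1 : (y - C (y.coeff 0)).coeff 0 = 0 := by
    rw [coeff_sub, C_apply, coeff_single_same, sub_self]
  generalize y - C (y.coeff 0) = z at hz0 hmem hz1
  have hne : z.order ≠ 0 := fun h => hz0 (coeff_order_eq_zero.1 (by rw [h, hz1]))
  rcases hne.lt_or_gt with h | h
  · exact ⟨-z.order, neg_pos.2 h, single_neg_mem hmem⟩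
  · exact ⟨z.order, h, hmem⟩

end Tail

variable {K : Type u} [Field K] [LinearOrder K] [IsStrictOrderedRing K] {L : FunctionFamily K}
  {Γ : Type v} [AddCommGroup Γ] [LinearOrder Γ] [IsOrderedAddMonoid Γ]
  [Module L.exponents Γ] {n : ℕ}

/-- If `F` does not involve the variables for which `y` and `y'` differ, then its values at `y` and
`y'` coincide. -/
theorem eval_congr (hmin : IsOMinimal L.language K) {F : L.Series n} {y y' : Fin n → HahnSeries Γ K}
    (hy : ∀ i, 0 < (y i).leadingCoeff) (hy' : ∀ i, 0 < (y' i).leadingCoeff)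
    (h : ∀ i, y i = y' i ∨ ∀ γ, F.coeff γ ≠ 0 → γ i = 0) : F.eval y = F.eval y' := by
  rw [Series.eval, Series.eval]
  refine congrArg hahnSum (funext fun p => ?_)
  by_cases hp : F.coeff p.1 = 0
  · simp [hp]
  by_cases hm : ∃ i, p.1 i = 0 ∧ p.2 i ≠ 0
  · obtain ⟨i, hi, hi'⟩ := hm
    have h0 : ∀ z : Fin n → HahnSeries Γ K, ∏ i, genBinom (p.1 i : K) (p.2 i) *
        L.power ((p.1 i : K) - p.2 i) (z i).leadingCoeff = 0 := fun z => by
      refine Finset.prod_eq_zero (Finset.mem_univ i) ?_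
      rw [hi, ZeroMemClass.coe_zero, genBinom_zero_left hi', zero_mul]
    rw [h0, h0, mul_zero, map_zero, zero_mul, zero_mul, zero_mul, zero_mul]
  · push Not at hm
    have h1 : ∀ i, y i = y' i ∨ p.1 i = 0 ∧ p.2 i = 0 := fun i =>
      (h i).imp_right fun h => ⟨h _ hp, hm i (h _ hp)⟩
    have e1 : ∏ i, genBinom (p.1 i : K) (p.2 i) * L.power ((p.1 i : K) - p.2 i)
        (y i).leadingCoeff = ∏ i, genBinom (p.1 i : K) (p.2 i) *
          L.power ((p.1 i : K) - p.2 i) (y' i).leadingCoeff := by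
      refine Finset.prod_congr rfl fun i _ => ?_
      rcases h1 i with h | ⟨h, h'⟩
      · rw [h]
      · rw [h, h', ZeroMemClass.coe_zero, Nat.cast_zero, sub_zero, power_zero hmin (hy i),
          power_zero hmin (hy' i)]
    have e2 : ∑ i, p.1 i • (y i).order = ∑ i, p.1 i • (y' i).order := by
      refine Finset.sum_congr rfl fun i _ => ?_
      rcases h1 i with h | ⟨h, -⟩
      · rw [h]
      · rw [h, zero_smul, zero_smul]
    have e3 : ∏ i, tail (y i) ^ p.2 i = ∏ i, tail (y' i) ^ p.2 i := by
      refine Finset.prod_congr rfl fun i _ => ?_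
      rcases h1 i with h | ⟨-, h⟩
      · rw [h]
      · rw [h, pow_zero, pow_zero]
    rw [e1, e2, e3]

variable [IsStrictOrderedModule L.exponents Γ]

/-- In the double sum defining `F.eval y`, summing first over `m` gives the powers
`(kᵢ + εᵢ) ^ γᵢ`. -/
theorem eval_eq_evalAt (F : L.Series n) {y : Fin n → HahnSeries Γ K} (hy : ∀ i, 0 < (y i).order) :
    F.eval y = evalAt (fun i a => L.power a (y i).leadingCoeff) (fun i => (y i).order)
      (fun i => tail (y i)) 0 F := by
  have hy0 : ∀ i, y i ≠ 0 := fun i h => (hy i).ne' (by rw [h, order_zero])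
  have hε : ∀ i, 0 < (tail (y i)).orderTop := fun i => orderTop_tail_pos (y i)
  choose t ht hts using fun γ : Fin n → L.exponents => exists_summableFamily_pi fun i =>
    SummableFamily.powerSeriesFamily (tail (y i))
      (binomialPower (fun a => L.power a (y i).leadingCoeff) (γ i : K))
  have htm : ∀ γ m, t γ m = ∏ i, (genBinom (γ i : K) (m i) *
      L.power ((γ i : K) - m i) (y i).leadingCoeff) • tail (y i) ^ m i := fun γ m => by
    rw [ht]
    refine Finset.prod_congr rfl fun i _ => ?_
    rw [SummableFamily.powerSeriesFamily_of_orderTop_pos (hε i), coeff_binomialPower]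
  obtain ⟨h1, h2⟩ := summable_weighted hy F (fun γ m => t γ m) (isPWO_closure_support hε)
    (fun γ m => by
      rw [htm]
      refine support_prod_subset _ _ _ fun i _ => (support_smul_subset _ _).trans
        ((SummableFamily.support_pow_subset_closure _ _).trans
          (AddSubmonoid.closure_mono (Set.subset_iUnion (fun i => (tail (y i)).support) i))))
    fun γ g => (t γ).finite_co_support g
  have hterm : ∀ p : (Fin n → L.exponents) × (Fin n → ℕ),
      C (F.coeff p.1 * ∏ i, genBinom (p.1 i : K) (p.2 i) *
        L.power ((p.1 i : K) - p.2 i) (y i).leadingCoeff) *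
      single (∑ i, p.1 i • (y i).order) 1 * ∏ i, tail (y i) ^ p.2 i =
      single (weight (fun i => (y i).order) p.1) (F.coeff p.1) * t p.1 p.2 := fun p => by
    rw [htm, prod_smul_eq_C_mul, map_mul, weight, C_mul_C_mul_single]
  obtain ⟨s, hs⟩ : ∃ s : SummableFamily Γ K ((Fin n → L.exponents) × (Fin n → ℕ)), ∀ p,
      s p = single (weight (fun i => (y i).order) p.1) (F.coeff p.1) * t p.1 p.2 :=
    ⟨⟨_, h1, h2⟩, fun p => rfl⟩
  have hsum : F.eval y = s.hsum := by
    rw [← hahnSum_coe, Series.eval, funext hterm, ← funext hs]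
  obtain ⟨w, hw, hws⟩ := exists_evalAt_family (fun i a => L.power a (y i).leadingCoeff) hy hε 0 F
  rw [hsum, hws]
  ext g
  rw [SummableFamily.coeff_hsum, SummableFamily.coeff_hsum, finsum_curry _ (s.finite_co_support g)]
  refine finsum_congr fun γ => ?_
  have h3 : powerProd (fun i a => L.power a (y i).leadingCoeff) (fun i => tail (y i)) 0 γ =
      (t γ).hsum := by
    rw [hts, powerProd]
    refine Finset.prod_congr rfl fun i _ => ?_
    rw [PowerSeries.heval_apply, Pi.zero_apply, Nat.cast_zero, sub_zero]
  rw [hw, h3, ← SummableFamily.hsum_smul, SummableFamily.coeff_hsum]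
  refine finsum_congr fun m => ?_
  rw [SummableFamily.smul_apply, of_symm_smul_of_eq_mul, hs]

/-- The values of a truncation-closed algebra at tuples of positive infinitesimals all of whose
truncations belong to `R` have the same property, if `R` is closed under such values. -/
theorem IsTruncationAlgebra.eval_mem_coreRing {A : Subring (L.Series n)}
    (hA : IsTruncationAlgebra A) (hmin : IsOMinimal L.language K) {R : Subfield (HahnSeries Γ K)}
    (hC : ∀ c : K, (C c : HahnSeries Γ K) ∈ R)
    (hR : ∀ y : Fin n → HahnSeries Γ K, (∀ i, 0 < (y i).order) → (∀ i, 0 < (y i).leadingCoeff) →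
      (∀ i, y i ∈ R) → ∀ F ∈ A, F.eval y ∈ R)
    {y : Fin n → HahnSeries Γ K} (hy : ∀ i, 0 < (y i).order) (hy' : ∀ i, 0 < (y i).leadingCoeff)
    (hyR : ∀ i, y i ∈ coreRing R) {F : L.Series n} (hF : F ∈ A) : F.eval y ∈ coreRing R := by
  have hy0 : ∀ i, y i ≠ 0 := fun i h => (hy i).ne' (by rw [h, order_zero])
  rw [eval_eq_evalAt F hy]
  refine hA.evalAt_mem_coreRing (k := fun i => (y i).leadingCoeff) (fun i => (hy' i).ne')
    (fun i a => power_add_one hmin a (hy' i)) hy hC (fun ε hε hεR F hF => ?_) _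
    (fun i => orderTop_tail_pos (y i)) (fun i => tail_mem_coreRing hC (hyR i) (hy0 i)) F hF 0
  have h := fun i => order_single_mul_C_add (v := (y i).order) (hy' i).ne' (hε i)
  have heval := eval_eq_evalAt F
    (y := fun i => single (y i).order 1 * (C (y i).leadingCoeff + ε i))
    (fun i => by rw [(h i).1]; exact hy i)
  simp only [(h _).1, (h _).2.1, (h _).2.2] at heval
  rw [← heval]
  exact hR _ (fun i => by rw [(h i).1]; exact hy i) (fun i => by rw [(h i).2.1]; exact hy' i)
    (fun i => mul_mem (single_order_mem hC (hyR i) (hy0 i)) (add_mem (hC _) (hεR i).1)) F hF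

theorem evalAt_C {pw : Fin n → K → K} (hpw : ∀ i, pw i 0 = 1) {v : Fin n → Γ} (hv : ∀ i, 0 < v i)
    {ε : Fin n → HahnSeries Γ K} (hε : ∀ i, 0 < (ε i).orderTop) (c : K) :
    evalAt pw v ε 0 (C c : L.Series n) = C c := by
  classical
  obtain ⟨s, hs, h1⟩ := exists_evalAt_family pw hv hε 0 (C c : L.Series n)
  have h2 : s = SummableFamily.single 0 (C c) := by
    ext1 γ
    rw [hs, SummableFamily.single_toFun]
    by_cases hγ : γ = 0
    · subst hγ
      have : powerProd pw ε 0 (0 : Fin n → L.exponents) = 1 := by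
        refine Finset.prod_eq_one fun i _ => ?_
        have h0 : (((0 : Fin n → L.exponents) i : L.exponents) : K) -
            ((0 : Fin n → ℕ) i : ℕ) = 0 := by
          simp
        rw [h0, binomialPower_zero (hpw i), map_one]
      rw [this, Pi.single_eq_same]
      simp [weight, C_apply]
    · rw [Pi.single_eq_of_ne hγ, C_apply, coeff_single_of_ne hγ, single_eq_zero, zero_mul]
  rw [h1, h2, SummableFamily.hsum_single]

/-- The constant series form a truncation-closed algebra. -/
theorem isTruncationAlgebra_range_C : IsTruncationAlgebra (C : K →+* L.Series n).range where
  C_mem c := ⟨c, rfl⟩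
  fragment_mem := by
    rintro _ ⟨c, rfl⟩ i b
    by_cases h : 0 < b
    · refine ⟨c, (fragment_eq_self fun γ hγ => ?_).symm⟩
      rw [eq_of_mem_support_single hγ]
      exact h
    · refine ⟨0, ?_⟩
      ext γ
      by_cases hγ : γ ∈ {γ : Fin n → L.exponents | γ i < b}
      · rw [coeff_fragment_of_mem _ hγ, C_apply, C_apply, coeff_single_of_ne,
          coeff_single_of_ne] <;>
        · rintro rfl
          exact h hγ
      · rw [coeff_fragment_of_notMem _ hγ, C_zero, coeff_zero]
  euler_mem := by
    rintro _ ⟨c, rfl⟩ i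
    refine ⟨0, ?_⟩
    ext γ
    by_cases hγ : γ = 0
    · subst hγ
      simp [Series.euler]
    · simp [Series.euler, C_apply, coeff_single_of_ne hγ]

/-- Up to a monomial, the inverse of `y` is `(k + ε)⁻¹`, which is the value of the series `1` after
division by `k + ε`. The monomial `t ^ w` that is evaluated at is irrelevant. -/
theorem inv_mem_coreRing (L : FunctionFamily K) [Module L.exponents Γ]
    [IsStrictOrderedModule L.exponents Γ] (hmin : IsOMinimal L.language K)
    {R : Subfield (HahnSeries Γ K)} (hC : ∀ c : K, (C c : HahnSeries Γ K) ∈ R)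
    (hΓ : ∃ w : Γ, 0 < w) {y : HahnSeries Γ K} (hy : y ∈ coreRing R) : y⁻¹ ∈ coreRing R := by
  have key : ∀ y ∈ coreRing R, 0 < y.leadingCoeff → y⁻¹ ∈ coreRing R := by
    intro y hy hpos
    obtain ⟨w, hw⟩ := hΓ
    have hy0 : y ≠ 0 := leadingCoeff_ne_zero.1 hpos.ne'
    set pw : Fin 1 → K → K := fun _ a => L.power a y.leadingCoeff with hpw_def
    have hpw : ∀ i a, pw i (a + 1) = y.leadingCoeff * pw i a := fun i a =>
      power_add_one hmin a hpos
    have hpw0 : ∀ i, pw i 0 = 1 := fun i => power_zero hmin hpos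
    have hv : ∀ i : Fin 1, 0 < (fun _ => w : Fin 1 → Γ) i := fun _ => hw
    have hmem := (isTruncationAlgebra_range_C (L := L) (n := 1)).evalAt_mem_coreRing
      (k := fun _ => y.leadingCoeff) (fun _ => hpos.ne') hpw hv hC
      (fun ε hε _ F hF => by
        obtain ⟨c, rfl⟩ := hF
        rw [evalAt_C hpw0 hv hε]
        exact hC c)
      (fun _ => tail y) (fun _ => orderTop_tail_pos y) (fun _ => tail_mem_coreRing hC hy hy0)
      (C 1) ⟨1, rfl⟩ fun _ => 1
    have hmul := evalAt_mul_prod_pow hpw hv (ε := fun _ => tail y)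
      (fun _ => orderTop_tail_pos y) (fun _ => 1) (C 1 : L.Series 1)
    rw [evalAt_C hpw0 hv fun _ => orderTop_tail_pos y] at hmul
    simp only [Fin.prod_univ_one, pow_one, C_one] at hmul
    rw [C_one, eq_inv_of_mul_eq_one_left hmul] at hmem
    rw [← single_order_mul_tail y, mul_inv, inv_single, inv_one]
    exact mul_mem (single_mem_truncationCore R (single_neg_mem (single_order_mem hC hy hy0))) hmem
  rcases lt_trichotomy y.leadingCoeff 0 with h | h | h
  · rw [← neg_neg y⁻¹, ← inv_neg]
    exact neg_mem (key _ (neg_mem hy) (by rwa [leadingCoeff_neg, neg_pos]))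
  · rw [leadingCoeff_eq_zero.1 h, inv_zero]
    exact zero_mem _
  · exact key y hy h

end FunctionFamily

/-! ### The interpretation of the function symbols -/

namespace FunctionFamily

open HahnSeries

section Order

variable {K : Type u} [Field K] {Γ : Type v}

theorem toLex_pos_iff [LinearOrder K] [LinearOrder Γ] {y : HahnSeries Γ K} :
    toLex 0 < toLex y ↔ 0 < y.leadingCoeff :=
  (leadingCoeff_pos_iff (x := toLex y)).symm

variable [AddCommGroup Γ] [LinearOrder Γ] [IsOrderedAddMonoid Γ]

theorem leadingCoeff_C_sub {r : K} (hr : r ≠ 0) {y : HahnSeries Γ K} (hy : 0 < y.orderTop) :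
    (C r - y).leadingCoeff = r := by
  rw [sub_eq_add_neg]
  exact (order_C_add hr (by rwa [orderTop_neg])).2

/-- A series between `0` and a constant `r` is the sum of an element of `[0, r]` and an
infinitesimal. -/
theorem coeff_bounds [LinearOrder K] {r : K} {y : HahnSeries Γ K} (h : toLex 0 < toLex y)
    (hr : toLex y < toLex (C r)) :
    (∀ b < 0, y.coeff b = 0) ∧ 0 ≤ y.coeff 0 ∧ y.coeff 0 ≤ r := by
  obtain ⟨i, hi, hi'⟩ := (lt_iff _ _).1 h
  obtain ⟨j, hj, hj'⟩ := (lt_iff _ _).1 hr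
  simp only [ofLex_toLex, coeff_zero] at hi hi' hj hj'
  have hC : ∀ b ≠ 0, (C r : HahnSeries Γ K).coeff b = 0 := fun b hb => coeff_single_of_ne hb
  have hC0 : (C r : HahnSeries Γ K).coeff 0 = r := coeff_single_same _ _
  -- The first nonzero coefficient of `y` is positive, the first one of `C r - y` as well.
  have hi0 : 0 ≤ i := by
    by_contra hlt
    rw [not_le] at hlt
    rcases lt_trichotomy i j with hij | rfl | hij
    · rw [hj i hij, hC i hlt.ne] at hi'
      exact hi'.false
    · rw [hC i hlt.ne] at hj'
      exact (hi'.trans hj').false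
    · rw [← hi j hij, hC j (hij.trans hlt).ne] at hj'
      exact hj'.false
  have hj0 : 0 ≤ j := by
    by_contra hlt
    rw [not_le] at hlt
    rw [← hi j (hlt.trans_le hi0), hC j hlt.ne] at hj'
    exact hj'.false
  refine ⟨fun b hb => (hi b (hb.trans_le hi0)).symm, ?_, ?_⟩
  · rcases hi0.lt_or_eq with h | rfl
    · rw [← hi 0 h]
    · exact hi'.le
  · rcases hj0.lt_or_eq with h | rfl
    · rw [hj 0 h, hC0]
    · rw [hC0] at hj'
      exact hj'.le

end Order

variable {K : Type u} [Field K] [LinearOrder K] [IsStrictOrderedRing K] {L : FunctionFamily K}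
  {Γ : Type v} [AddCommGroup Γ] [LinearOrder Γ] [IsOrderedAddMonoid Γ] {n : ℕ}

namespace SeriesRep

variable (T : L.SeriesRep)

theorem mem_germs {r : Fin n → {k : K // 0 < k}} {f : PosBox r → K} (hf : f ∈ L.alg r) :
    ((PosBox.extend f : (Fin n → K) → K) : (smallPos K n).Germ K) ∈ L.germs n :=
  ⟨r, f, hf, rfl⟩

theorem series_eq {g : (Fin n → K) → K} (hg : (g : (smallPos K n).Germ K) ∈ L.germs n) :
    T.series g = T.hom n ⟨_, hg⟩ :=
  dif_pos hg

theorem C_mem_range (c : K) : C c ∈ (T.hom n).range := by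
  have h : ((PosBox.extend (algebraMap K
      (PosBox (fun _ : Fin n => (⟨1, one_pos⟩ : {k : K // 0 < k})) → K) c) : (Fin n → K) → K) :
      (smallPos K n).Germ K) ∈ L.germs n :=
    mem_germs (Subalgebra.algebraMap_mem _ c)
  refine ⟨⟨_, h⟩, T.map_const n c _ (Filter.Germ.coe_eq.2 ?_)⟩
  exact eventually_smallPos.2 ⟨1, one_pos, fun z hz => by
    rw [PosBox.extend, dif_pos hz]
    rfl⟩

theorem isTruncationAlgebra_range (hE : L.IsEulerClosed) (htc : T.IsTruncationClosed) :
    IsTruncationAlgebra (T.hom n).range where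
  C_mem := T.C_mem_range
  fragment_mem := htc n
  euler_mem := by
    rintro _ ⟨⟨φ, r, f, hf, rfl⟩, rfl⟩ i
    obtain ⟨r', g, hg, h⟩ := hE n r f hf i
    exact ⟨⟨_, mem_germs hg⟩, T.map_euler n i _ _ _ _ rfl rfl h⟩

/-- The series of a function which does not depend on `xᵢ` does not involve the `i`-th variable. -/
theorem series_apply_eq_zero {g : (Fin n → K) → K}
    (hg : (g : (smallPos K n).Germ K) ∈ L.germs n) {i : Fin n}
    (hi : ∀ z t, g (Function.update z i t) = g z) {γ : Fin n → L.exponents}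
    (hγ : (T.series g).coeff γ ≠ 0) : γ i = 0 := by
  have h0 : ((fun _ => 0 : (Fin n → K) → K) : (smallPos K n).Germ K) ∈ L.germs n :=
    zero_mem (L.germs n)
  have h := T.map_euler n i ⟨_, hg⟩ ⟨_, h0⟩ g (fun _ => 0) rfl rfl <|
    Filter.Eventually.of_forall fun z => ⟨0, fun ε hε => ⟨1, one_pos, fun t _ => by
      simp only [hi, sub_self, zero_mul, abs_zero]
      positivity⟩, (mul_zero _).symm⟩
  have h1 : T.hom n ⟨_, h0⟩ = 0 := map_zero (T.hom n)
  rw [h1, ← T.series_eq hg] at h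
  have h2 := congrArg (fun F => HahnSeries.coeff F γ) h
  simp only [coeff_zero, Series.euler] at h2
  exact Subtype.ext ((mul_eq_zero.1 h2.symm).resolve_right hγ)

end SeriesRep

variable [Module L.exponents Γ]

open scoped Classical in
/-- At positive infinitesimals, a function symbol is interpreted by the series of its function. -/
theorem interpret_eq_eval (T : L.SeriesRep) {r : Fin n → {k : K // 0 < k}} (f : L.alg r)
    {y : Fin n → HahnSeries Γ K} (hy : ∀ i, 0 < (y i).order)
    (hy' : ∀ i, 0 < (y i).leadingCoeff) :
    T.interpret f y = (T.series (PosBox.extend f.1)).eval y := by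
  have hy0 : ∀ i, y i ≠ 0 := fun i => leadingCoeff_ne_zero.1 (hy' i).ne'
  have hc : ∀ i, (y i).coeff 0 = 0 := fun i => coeff_eq_zero_of_lt_order (hy i)
  rw [SeriesRep.interpret, if_pos]
  · have h1 : (fun i => if y i - C ((y i).coeff 0) = 0 then 1 else
        C ((SignType.sign (y i - C ((y i).coeff 0)).leadingCoeff : SignType) : K) *
          (y i - C ((y i).coeff 0))) = y := by
      funext i
      simp only [hc, C_zero, sub_zero, if_neg (hy0 i), sign_pos (hy' i)]
      simp
    have h2 : (fun z : Fin n → K => PosBox.extend f.1 fun i => (y i).coeff 0 +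
        ((SignType.sign (y i - C ((y i).coeff 0)).leadingCoeff : SignType) : K) * z i) =
        PosBox.extend f.1 := by
      funext z
      congr 1
      funext i
      rw [hc, C_zero, sub_zero, sign_pos (hy' i)]
      simp
    simp only [h1, h2]
  · refine fun i => ⟨toLex_pos_iff.2 (hy' i), ?_⟩
    rw [← sub_pos, ← toLex_sub]
    refine toLex_pos_iff.2 ?_
    rw [leadingCoeff_C_sub (r i).2.ne']
    · exact (r i).2
    · rw [← order_eq_orderTop_of_ne_zero (hy0 i)]
      exact WithTop.coe_lt_coe.2 (hy i)

variable [IsStrictOrderedModule L.exponents Γ]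

open scoped Classical in
/-- If a field `R` is closed under the function symbols, then so is the ring of the series
all of whose truncations belong to `R`. -/
theorem interpret_mem_coreRing (T : L.SeriesRep) (hmin : IsOMinimal L.language K)
    (hA : L.IsAnalytic) (hE : L.IsEulerClosed) (htc : T.IsTruncationClosed)
    {R : Subfield (HahnSeries Γ K)} (hC : ∀ c : K, (C c : HahnSeries Γ K) ∈ R)
    (hR : ∀ {n : ℕ} {r : Fin n → {k : K // 0 < k}} (f : L.alg r) (y : Fin n → HahnSeries Γ K),
      (∀ i, y i ∈ R) → T.interpret f y ∈ R)
    {w : Γ} (hw : 0 < w) (hwR : (single w 1 : HahnSeries Γ K) ∈ R)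
    {r : Fin n → {k : K // 0 < k}} (f : L.alg r) {y : Fin n → HahnSeries Γ K}
    (hy : ∀ i, y i ∈ coreRing R) : T.interpret f y ∈ coreRing R := by
  rw [SeriesRep.interpret]
  by_cases h : ∀ i, toLex 0 < toLex (y i) ∧ toLex (y i) < toLex (C (r i : K))
  swap
  · rw [if_neg h]
    exact zero_mem _
  rw [if_pos h]
  have hb := fun i => coeff_bounds (h i).1 (h i).2
  let x : Fin n → K := fun i => (y i).coeff 0
  let ε : Fin n → HahnSeries Γ K := fun i => y i - C (x i)
  let σ : Fin n → SignType := fun i => SignType.sign (ε i).leadingCoeff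
  set g : (Fin n → K) → K := fun z => PosBox.extend f.1 fun i => x i + (σ i : K) * z i with hg_def
  have hg : (g : (smallPos K n).Germ K) ∈ L.germs n := by
    obtain ⟨r', f', hf', h'⟩ := hA n r f.1 f.2 x (fun i => (hb i).2) σ
    exact ⟨r', f', hf', Filter.Germ.coe_eq.2 h'⟩
  have hεt : ∀ i, 0 < (ε i).orderTop := fun i => orderTop_pos_of_coeff_eq_zero fun b hb' => by
    rcases hb'.lt_or_eq with hlt | rfl
    · rw [coeff_sub, (hb i).1 b hlt, C_apply, coeff_single_of_ne hlt.ne, sub_zero]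
    · rw [coeff_sub, C_apply, coeff_single_same, sub_self]
  -- Variables which do not occur may be given any positive infinitesimal value.
  set y₁ : Fin n → HahnSeries Γ K := fun i => if ε i = 0 then 1 else C (σ i : K) * ε i with hy₁
  set y₂ : Fin n → HahnSeries Γ K := fun i => if ε i = 0 then single w 1 else C (σ i : K) * ε i
    with hy₂
  have hlc : ∀ i, ε i ≠ 0 →
      0 < (C (σ i : K) * ε i).leadingCoeff ∧ 0 < (C (σ i : K) * ε i).order := by
    intro i hi
    have hlead := leadingCoeff_ne_zero.2 hi
    have hσ : (σ i : K) ≠ 0 ∧ 0 < (σ i : K) * (ε i).leadingCoeff := by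
      rcases hlead.lt_or_gt with hneg | hpos
      · have : σ i = -1 := sign_neg hneg
        rw [this]
        simpa using hneg
      · have : σ i = 1 := sign_pos hpos
        rw [this]
        simpa using hpos
    have hCσ : (C (σ i : K) : HahnSeries Γ K) ≠ 0 := C_ne_zero hσ.1
    refine ⟨?_, ?_⟩
    · rw [leadingCoeff_mul, C_apply, leadingCoeff_of_single]
      exact hσ.2
    · rw [order_mul hCσ hi, order_C, zero_add]
      have := hεt i
      rw [← order_eq_orderTop_of_ne_zero hi] at this
      exact WithTop.coe_lt_coe.1 this
  have hpos₁ : ∀ i, 0 < (y₁ i).leadingCoeff := fun i => by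
    by_cases hi : ε i = 0
    · simp [hy₁, hi]
    · simpa only [hy₁, if_neg hi] using (hlc i hi).1
  have hpos₂ : ∀ i, 0 < (y₂ i).leadingCoeff := fun i => by
    by_cases hi : ε i = 0
    · simp [hy₂, hi]
    · simpa only [hy₂, if_neg hi] using (hlc i hi).1
  have hord₂ : ∀ i, 0 < (y₂ i).order := fun i => by
    by_cases hi : ε i = 0
    · simpa only [hy₂, if_pos hi, order_single (one_ne_zero (α := K))] using hw
    · simpa only [hy₂, if_neg hi] using (hlc i hi).2
  have heq : (T.series g).eval y₁ = (T.series g).eval y₂ := by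
    refine eval_congr hmin hpos₁ hpos₂ fun i => ?_
    by_cases hi : ε i = 0
    · refine Or.inr fun γ hγ => T.series_apply_eq_zero hg (fun z t => ?_) hγ
      have hσ : σ i = 0 := by
        change SignType.sign (ε i).leadingCoeff = 0
        rw [hi, leadingCoeff_zero, sign_zero]
      refine congrArg (PosBox.extend f.1) (funext fun j => ?_)
      by_cases hj : j = i
      · subst hj
        simp [hσ]
      · rw [Function.update_of_ne hj]
    · exact Or.inl (by simp only [hy₁, hy₂, if_neg hi])
  change (T.series g).eval y₁ ∈ coreRing R
  rw [heq]
  refine (T.isTruncationAlgebra_range hE htc).eval_mem_coreRing hmin hC ?_ hord₂ hpos₂ (fun i => ?_)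
    (F := T.series g) (by rw [T.series_eq hg]; exact ⟨_, rfl⟩)
  · rintro y h1 h2 h3 _ ⟨⟨_, r', f', hf', rfl⟩, rfl⟩
    have := hR ⟨f', hf'⟩ y h3
    rwa [interpret_eq_eval T ⟨f', hf'⟩ h1 h2, T.series_eq (SeriesRep.mem_germs hf')] at this
  · by_cases hi : ε i = 0
    · simp only [hy₂, if_pos hi]
      exact single_mem_truncationCore R hwR
    · simp only [hy₂, if_neg hi]
      exact mul_mem (C_mem_coreRing hC _) (sub_mem (hy i) (C_mem_coreRing hC _))

end FunctionFamily

/-! ### Generated substructures of the Hahn field -/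

namespace FunctionFamily

open HahnSeries Language

variable {K : Type u} [Field K] [LinearOrder K] [IsStrictOrderedRing K] {L : FunctionFamily K}
  {Γ : Type v} [AddCommGroup Γ] [LinearOrder Γ] [IsOrderedAddMonoid Γ] [Module L.exponents Γ]

namespace SeriesRep

variable {T : L.SeriesRep}

/-- A substructure of the Hahn field is a subfield, as its language contains that of fields with
inversion. -/
def substructureSubfield (S : L.language.Substructure (T.Hahn Γ)) :
    Subfield (HahnSeries Γ K) where
  carrier := {y : HahnSeries Γ K | (show T.Hahn Γ from y) ∈ S}
  mul_mem' {a b} ha hb := S.fun_mem (show L.language.Functions 2 from Func.mul)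
    ![(show T.Hahn Γ from a), (show T.Hahn Γ from b)] (Fin.forall_fin_two.2 ⟨ha, hb⟩)
  one_mem' := S.fun_mem (show L.language.Functions 0 from Func.one) ![] fun i => i.elim0
  add_mem' {a b} ha hb := S.fun_mem (show L.language.Functions 2 from Func.add)
    ![(show T.Hahn Γ from a), (show T.Hahn Γ from b)] (Fin.forall_fin_two.2 ⟨ha, hb⟩)
  zero_mem' := S.fun_mem (show L.language.Functions 0 from Func.zero) ![] fun i => i.elim0
  neg_mem' {a} ha := S.fun_mem (show L.language.Functions 1 from Func.neg)
    ![(show T.Hahn Γ from a)] (Fin.forall_fin_one.2 ha)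
  inv_mem' a ha := S.fun_mem (show L.language.Functions 1 from Func.inv)
    ![(show T.Hahn Γ from a)] (Fin.forall_fin_one.2 ha)

theorem interpret_mem_substructureSubfield (S : L.language.Substructure (T.Hahn Γ)) {n : ℕ}
    {r : Fin n → {k : K // 0 < k}} (f : L.alg r) (y : Fin n → HahnSeries Γ K)
    (hy : ∀ i, y i ∈ substructureSubfield S) : T.interpret f y ∈ substructureSubfield S :=
  S.fun_mem (show L.language.Functions n from Func.sym r f) y hy

variable [IsStrictOrderedModule L.exponents Γ]

/-- The substructure generated by a set of series is truncation-closed if it contains the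
truncations of the generators: the elements all of whose truncations belong to it form a
substructure. -/
theorem truncationClosed_closure (hmin : IsOMinimal L.language K) (hserial : T.IsSerial Γ)
    (htc : T.IsTruncationClosed) {A : Set (T.Hahn Γ)} (hC : ∀ k, T.const Γ k ∈ A)
    (hA : ∀ y ∈ A, ∀ g : Γ, HahnSeries.truncation y g ∈
      (Substructure.closure L.language A : Set (T.Hahn Γ))) :
    TruncationClosed (G := Γ) (R := K) (Substructure.closure L.language A : Set (T.Hahn Γ)) := by
  set S := Substructure.closure L.language A
  set R := substructureSubfield S
  have hCR : ∀ c : K, (C c : HahnSeries Γ K) ∈ R := fun c =>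
    Substructure.subset_closure (M := T.Hahn Γ) (hC c)
  have hAR : ∀ y ∈ A, y ∈ coreRing R := fun y hy => 
    ⟨Substructure.subset_closure (M := T.Hahn Γ) hy, hA y hy⟩
  by_cases hconst : ∀ y ∈ coreRing R, ∃ c, y = C c
  -- If all generators are constants, the substructure is the image of `K`.
  · obtain ⟨j, hj⟩ := hserial.elementary
    have hle : S ≤ j.toHom.range := Substructure.closure_le.2 fun y hy => by
      obtain ⟨c, hc⟩ := hconst y (hAR y hy)
      exact ⟨c, (hj c).trans hc.symm⟩
    intro y hy g
    obtain ⟨c, rfl⟩ := hle hy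
    have hc : j.toHom c = T.const Γ c := hj c
    rw [hc]
    exact hA _ (hC c) g
  · push Not at hconst
    obtain ⟨y, hy, hyc⟩ := hconst
    obtain ⟨w, hw, hwR⟩ := exists_single_mem hCR hy hyc
    let B : L.language.Substructure (T.Hahn Γ) :=
      { carrier := {y : T.Hahn Γ | (show HahnSeries Γ K from y) ∈ coreRing R}
        fun_mem := fun {n} F y hyB => by
          have hy : ∀ i, (show HahnSeries Γ K from y i) ∈ coreRing R := hyB
          cases F with
          | zero => exact zero_mem (coreRing R)
          | one => exact one_mem (coreRing R)
          | neg => exact neg_mem (hy 0)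
          | inv => exact inv_mem_coreRing L hmin hCR ⟨w, hw⟩ (hy 0)
          | add => exact add_mem (hy 0) (hy 1)
          | mul => exact mul_mem (hy 0) (hy 1)
          | sym r f =>
            exact interpret_mem_coreRing T hmin hserial.analytic hserial.eulerClosed htc hCR
              (interpret_mem_substructureSubfield S) hw hwR f hy }
    have hle : S ≤ B := Substructure.closure_le.2 hAR
    exact fun y hy g => (hle hy).2 g

end SeriesRep

end FunctionFamily

end

theorem mainTheorem4 {K : Type u} [Field K] [LinearOrder K] [IsStrictOrderedRing K]
    (L : FunctionFamily K) (hmin : IsOMinimal L.language K) (hpow : L.IsPowerBounded)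
    (T : L.SeriesRep)
    {Γ : Type v} [AddCommGroup Γ] [LinearOrder Γ] [IsOrderedAddMonoid Γ]
    [Module L.exponents Γ] [IsStrictOrderedModule L.exponents Γ]
    (hserial : T.IsSerial Γ) (htc : T.IsTruncationClosed)
    (E : L.language.ElementarySubstructure (T.Hahn Γ))
    (hKE : ∀ k : K, T.const Γ k ∈ E)
    (hE : TruncationClosed (G := Γ) (R := K) (E : Set (T.Hahn Γ)))
    (x : T.Hahn Γ)
    (hx : ∀ g : Γ, HahnSeries.truncation x g ≠ x →
      HahnSeries.truncation x g ∈ (E : Set (T.Hahn Γ))) :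
    TruncationClosed (G := Γ) (R := K)
      (definableClosure L.language (M := T.Hahn Γ) ((E : Set (T.Hahn Γ)) ∪ {x})) := by
  obtain ⟨j, -⟩ := hserial.elementary
  rw [Set.Subset.antisymm
    (definableClosure_subset_closure hserial.skolem j.elementarilyEquivalent _)
    (closure_subset_definableClosure _)]
  refine FunctionFamily.SeriesRep.truncationClosed_closure hmin hserial htc
    (fun k => Or.inl (hKE k)) ?_
  rintro y (hy | rfl) g
  · exact FirstOrder.Language.Substructure.subset_closure (M := T.Hahn Γ) (Or.inl (hE y hy g))
  · by_cases hg : HahnSeries.truncation y g = y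
    · rw [hg]
      exact FirstOrder.Language.Substructure.subset_closure (M := T.Hahn Γ) (Or.inr rfl)
    · exact FirstOrder.Language.Substructure.subset_closure (M := T.Hahn Γ) (Or.inl (hx g hg))
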